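/- For $n\ge 1$ let $\mathcal X_{2n}$ be the set of permutations $\sigma=\sigma_1\cdots\sigma_{2n}$ of $[2n]=\{1,\dots,2n\}$ all of whose descents are even-odd, that is, $\sigma_i>\sigma_{i+1}$ implies that $\sigma_i$ is even and $\sigma_{i+1}$ is odd. For $\sigma\in\mathcal X_{2n}$ let $\mathrm{lema}\,\sigma$ and $\mathrm{loma}\,\sigma$ be the numbers of even and of odd left-to-right maxima (values $\sigma_i$ with $\sigma_j<\sigma_i$ for all $j<i$), and $\mathrm{remi}\,\sigma$ and $\mathrm{romi}\,\sigma$ the numbers of even and of odd right-to-left minima (values $\sigma_i$ with $\sigma_i<\sigma_j$ for all $j>i$). Let $\mathrm{des}\,\sigma$ be the number of descents, i.e. of indices $i$ with $\sigma_i>\sigma_{i+1}$; for such an $i$ the value $\sigma_i$ is called a descent top and $\sigma_{i+1}$ a descent bottom. Let $\mathrm{dom}\,\sigma$ be the number of $j\in\{1,\dots,n\}$ such that $2j$ is a descent top and $2j-1$ is a descent bottom of $\sigma$. Let $\mathrm{les}\,\sigma$ be the number of pairs $(i,j)$ with $2\le i<j\le 2n$ and $\sigma_{i-1}>\sigma_j>\sigma_i$,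 and $\mathrm{res}\,\sigma$ the number of pairs $(i,j)$ with $1\le i<j\le 2n-1$ and $\sigma_j>\sigma_i>\sigma_{j+1}$. Put $$X_n(a,\bar a,b,\bar b,p,q,y,t)=\sum_{\sigma\in\mathcal X_{2n}} a^{\mathrm{lema}\,\sigma}\,\bar a^{\mathrm{loma}\,\sigma}\,b^{\mathrm{romi}\,\sigma}\,\bar b^{\mathrm{remi}\,\sigma}\,p^{\mathrm{res}\,\sigma}\,q^{\mathrm{les}\,\sigma}\,y^{\mathrm{dom}\,\sigma}\,t^{\mathrm{des}\,\sigma}.$$ For $n\ge1$ let $$[x,n]_{p,q}=xp^{n-1}+\sum_{i=1}^{n-1}p^{n-1-i}q^i ,$$ and let $[x,1,z]_{p,q}=xz$ and, for $n\ge 2$, $$[x,n,z]_{p,q}=xp^{n-1}+\sum_{i=1}^{n-2}p^{n-1-i}q^i+zq^{n-1}.$$ **Theorem.** As formal power series in $x$, $$1+\sum_{n\ge1}X_n(a,\bar a,b,\bar b,p,q,y,t)\,x^n=\cfrac{1}{1-b_0x-\cfrac{\lambda_1x^2}{1-b_1x-\cfrac{\lambda_2x^2}{1-b_2x-\cdots}}},$$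 where for all $n\ge 1$ $$b_{n-1}=[\bar a,n,b]_{p,q}\,[a,n,\bar b]_{p,q}+ty\,[a,n]_{p,q}\,[b,n]_{q,p},$$ $$\lambda_n=t\,[a,n]_{p,q}\,[a,n+1,\bar b]_{p,q}\,[b,n]_{q,p}\,[\bar a,n+1,b]_{p,q}.$$ In particular $b_0=ab(\bar a\bar b+ty)$ and $\lambda_1=abt(ap+\bar bq)(\bar ap+bq)$. The infinite continued fraction denotes the coefficientwise limit of its finite convergents. The identity holds with $a,\bar a,b,\bar b,p,q,y,t$ being indeterminates, and equivalently for arbitrary elements of an arbitrary commutative ring. -/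

import Mathlib

open Filter

namespace EvenOddDescent

/-! ### Permutations of `{1, …, m}` as words `σ₁ σ₂ … σ_m`

A permutation of `[m]` is an element of `Equiv.Perm (Fin m)`. Positions are elements of `Fin m`
(shifted by one), and the letters are the natural numbers `1, …, m`. -/

/-- The letter of `σ` at position `i`, a number in `{1, …, m}`. -/
def letter {m : ℕ} (σ : Equiv.Perm (Fin m)) (i : Fin m) : ℕ := (σ i : ℕ) + 1

/-- `j` is the position immediately after `i`, and the letter at `i` exceeds the letter at `j`. -/
def IsDescent {m : ℕ} (σ : Equiv.Perm (Fin m)) (i j : Fin m) : Prop :=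
  (i : ℕ) + 1 = (j : ℕ) ∧ letter σ j < letter σ i

instance {m : ℕ} (σ : Equiv.Perm (Fin m)) (i j : Fin m) : Decidable (IsDescent σ i j) :=
  inferInstanceAs (Decidable (_ ∧ _))

/-- The value `v` is a descent top of `σ`. -/
def IsDescentTop {m : ℕ} (σ : Equiv.Perm (Fin m)) (v : ℕ) : Prop :=
  ∃ i j : Fin m, IsDescent σ i j ∧ letter σ i = v

instance {m : ℕ} (σ : Equiv.Perm (Fin m)) (v : ℕ) : Decidable (IsDescentTop σ v) :=
  inferInstanceAs (Decidable (∃ _, _))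

/-- The value `v` is a descent bottom of `σ`. -/
def IsDescentBottom {m : ℕ} (σ : Equiv.Perm (Fin m)) (v : ℕ) : Prop :=
  ∃ i j : Fin m, IsDescent σ i j ∧ letter σ j = v

instance {m : ℕ} (σ : Equiv.Perm (Fin m)) (v : ℕ) : Decidable (IsDescentBottom σ v) :=
  inferInstanceAs (Decidable (∃ _, _))

/-- Every descent of `σ` has an even top and an odd bottom. -/
def IsEvenOddDescent {m : ℕ} (σ : Equiv.Perm (Fin m)) : Prop :=
  ∀ i j : Fin m, IsDescent σ i j → Even (letter σ i) ∧ Odd (letter σ j)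

instance {m : ℕ} (σ : Equiv.Perm (Fin m)) : Decidable (IsEvenOddDescent σ) :=
  inferInstanceAs (Decidable (∀ _, _))

/-- The letter at position `i` is a left-to-right maximum. -/
def IsLRMax {m : ℕ} (σ : Equiv.Perm (Fin m)) (i : Fin m) : Prop :=
  ∀ j : Fin m, j < i → letter σ j < letter σ i

instance {m : ℕ} (σ : Equiv.Perm (Fin m)) (i : Fin m) : Decidable (IsLRMax σ i) :=
  inferInstanceAs (Decidable (∀ _, _))

/-- The letter at position `i` is a right-to-left minimum. -/
def IsRLMin {m : ℕ} (σ : Equiv.Perm (Fin m)) (i : Fin m) : Prop :=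
  ∀ j : Fin m, i < j → letter σ i < letter σ j

instance {m : ℕ} (σ : Equiv.Perm (Fin m)) (i : Fin m) : Decidable (IsRLMin σ i) :=
  inferInstanceAs (Decidable (∀ _, _))

/-- Number of even left-to-right maxima. -/
def lema {m : ℕ} (σ : Equiv.Perm (Fin m)) : ℕ :=
  (Finset.univ.filter fun i : Fin m => IsLRMax σ i ∧ Even (letter σ i)).card

/-- Number of odd left-to-right maxima. -/
def loma {m : ℕ} (σ : Equiv.Perm (Fin m)) : ℕ :=
  (Finset.univ.filter fun i : Fin m => IsLRMax σ i ∧ Odd (letter σ i)).card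

/-- Number of even right-to-left minima. -/
def remi {m : ℕ} (σ : Equiv.Perm (Fin m)) : ℕ :=
  (Finset.univ.filter fun i : Fin m => IsRLMin σ i ∧ Even (letter σ i)).card

/-- Number of odd right-to-left minima. -/
def romi {m : ℕ} (σ : Equiv.Perm (Fin m)) : ℕ :=
  (Finset.univ.filter fun i : Fin m => IsRLMin σ i ∧ Odd (letter σ i)).card

/-- Number of descents. -/
def des {m : ℕ} (σ : Equiv.Perm (Fin m)) : ℕ :=
  (Finset.univ.filter fun d : Fin m × Fin m => IsDescent σ d.1 d.2).card

/-- Number of pairs `(i, j)` with `2 ≤ i < j` and `σ_{i-1} > σ_j > σ_i`;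
below `k` stands for the position `i - 1`. -/
def les {m : ℕ} (σ : Equiv.Perm (Fin m)) : ℕ :=
  (Finset.univ.filter fun d : Fin m × Fin m => d.1 < d.2 ∧
    ∃ k : Fin m, (k : ℕ) + 1 = (d.1 : ℕ) ∧
      letter σ d.2 < letter σ k ∧ letter σ d.1 < letter σ d.2).card

/-- Number of pairs `(i, j)` with `i < j` and `σ_j > σ_i > σ_{j+1}`;
below `k` stands for the position `j + 1`. -/
def res {m : ℕ} (σ : Equiv.Perm (Fin m)) : ℕ :=
  (Finset.univ.filter fun d : Fin m × Fin m => d.1 < d.2 ∧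
    ∃ k : Fin m, (d.2 : ℕ) + 1 = (k : ℕ) ∧
      letter σ d.1 < letter σ d.2 ∧ letter σ k < letter σ d.1).card

/-- Number of dominos of a permutation of `[2n]`: the `j ∈ {1, …, n}` such that `2j` is a
descent top and `2j - 1` is a descent bottom. -/
def dom {n : ℕ} (σ : Equiv.Perm (Fin (2 * n))) : ℕ :=
  ((Finset.Icc 1 n).filter fun j : ℕ =>
    IsDescentTop σ (2 * j) ∧ IsDescentBottom σ (2 * j - 1)).card

/-- The even-odd descent permutations of `[2n]`. -/
def evenOddPerms (n : ℕ) : Finset (Equiv.Perm (Fin (2 * n))) :=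
  Finset.univ.filter fun σ => IsEvenOddDescent σ

/-- The polynomial `X_n(a, a', b, b', p, q, y, t)`, evaluated at elements of a commutative ring
(for the polynomial itself, take the eight variables of a polynomial ring over `ℤ`). -/
def polyX {R : Type*} [CommRing R] (a abar b bbar p q y t : R) (n : ℕ) : R :=
  ∑ σ ∈ evenOddPerms n,
    a ^ lema σ * abar ^ loma σ * b ^ romi σ * bbar ^ remi σ *
      p ^ res σ * q ^ les σ * y ^ dom σ * t ^ des σ

/-! ### Generalized `(p,q)`-integers, for `n ≥ 1` -/

/-- `[x, n]_{p,q} = x p^{n-1} + ∑_{i=1}^{n-1} p^{n-1-i} q^i` for `n ≥ 1`. -/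
def pqInt {R : Type*} [CommRing R] (x : R) (n : ℕ) (p q : R) : R :=
  x * p ^ (n - 1) + ∑ i ∈ Finset.Icc 1 (n - 1), p ^ (n - 1 - i) * q ^ i

/-- `[x, n, z]_{p,q} = x p^{n-1} + ∑_{i=1}^{n-2} p^{n-1-i} q^i + z q^{n-1}` for `n ≥ 2`,
and `[x, 1, z]_{p,q} = x z`. -/
def pqIntTwo {R : Type*} [CommRing R] (x : R) (n : ℕ) (z p q : R) : R :=
  if n = 1 then x * z
  else x * p ^ (n - 1) + ∑ i ∈ Finset.Icc 1 (n - 2), p ^ (n - 1 - i) * q ^ i + z * q ^ (n - 1)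

/-! ### Formal J-fractions -/

/-- The power series `1 / (1 - β x - γ x² F)`; the denominator has constant coefficient `1`. -/
noncomputable def jStep {R : Type*} [CommRing R] (β γ : R) (F : PowerSeries R) : PowerSeries R :=
  PowerSeries.invOfUnit
    (1 - PowerSeries.C β * PowerSeries.X - PowerSeries.C γ * PowerSeries.X ^ 2 * F) 1

theorem denom_mul_jStep {R : Type*} [CommRing R] (β γ : R) (F : PowerSeries R) :
    (1 - PowerSeries.C β * PowerSeries.X - PowerSeries.C γ * PowerSeries.X ^ 2 * F) *
      jStep β γ F = 1 := by
  apply PowerSeries.mul_invOfUnit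
  simp

/-- The `m`-th convergent of the J-fraction with coefficients `β_k, β_{k+1}, …` and
`γ_{k+1}, γ_{k+2}, …`, that is
`1 / (1 - β_k x - γ_{k+1} x² / (1 - β_{k+1} x - … / (1 - β_{k+m-1} x)))`, and `0` for `m = 0`. -/
noncomputable def jConvergent {R : Type*} [CommRing R] (β γ : ℕ → R) :
    ℕ → ℕ → PowerSeries R
  | 0, _ => 0
  | m + 1, k => jStep (β k) (γ (k + 1)) (jConvergent β γ m (k + 1))

/-- `F` is the infinite J-fraction
`1 / (1 - β_0 x - γ_1 x² / (1 - β_1 x - γ_2 x² / (1 - β_2 x - …)))`: the convergents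
converge to `F` as formal power series, i.e. each coefficient is eventually that of `F`. -/
def IsJFraction {R : Type*} [CommRing R] (β γ : ℕ → R) (F : PowerSeries R) : Prop :=
  ∀ n : ℕ, ∀ᶠ m in atTop,
    PowerSeries.coeff n (jConvergent β γ m 0) = PowerSeries.coeff n F

/-- The coefficient of `x` at level `n - 1`, for `n ≥ 1`. -/
def coeffB {R : Type*} [CommRing R] (a abar b bbar p q y t : R) (n : ℕ) : R :=
  pqIntTwo abar n b p q * pqIntTwo a n bbar p q + t * y * pqInt a n p q * pqInt b n q p

/-- The coefficient `λ_n`, for `n ≥ 1`. -/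
def coeffLam {R : Type*} [CommRing R] (a abar b bbar p q t : R) (n : ℕ) : R :=
  t * pqInt a n p q * pqIntTwo a (n + 1) bbar p q * pqInt b n q p *
    pqIntTwo abar (n + 1) b p q

end EvenOddDescent

namespace EvenOddDescent

/-! A permutation is built by inserting its values in increasing order. After the values up to `k`,
the word consists of these letters and of gaps, each written `N` and standing for a nonempty run of
larger letters; a last gap always ends the word. Since `N` is even and larger than all letters,
`StepRel` says what is needed: any letter may precede a gap, only an odd one may follow it, and two
gaps are never adjacent.

An odd letter is no descent top, so a larger letter follows it: in its gap it comes first (`v N`,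
same number of gaps) or as a descent bottom (`N v N`, one gap more). An even letter is no descent
bottom: it comes first (`v N`) or closes the gap and becomes a descent top (`v`, one gap fewer); the
last gap cannot be closed. Every word arises exactly once (`mem_blockWords`, `nodup_blockWords`).

The contribution of a letter is fixed when it is inserted, because later insertions replace a gap by
a nonempty run of larger letters (`blockWeight_replace`). It depends only on the numbers `i` and `j`
of gaps to its left and right (`gapWeight`): apart from the last one, a gap becomes a run that ends
in a descent straddling the letter, which gives `q ^ i * p ^ j`, while left-to-right maxima and
right-to-left minima need `i = 0` and `j = 0`. Summing over the gaps yields the `(p,q)`-integers.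

Inserting `2j + 1` and `2j + 2` thus moves the height, the number of gaps minus one, by at most one.
The height is kept either by two insertions of type `v N`, or by opening and then closing a gap,
which makes a domino; these are the two terms of `coeffB`. An up step times the matching down step
is `coeffLam`. So `polyX` counts weighted Motzkin paths from 0 to 0 (`polyX_eq_iterate`), whose
generating function is the J-fraction (`isJFraction_pathSeries`). -/

/-- The tridiagonal operator with entries `U h : h → h + 1`, `β h : h → h`, `D h : h + 1 → h`. -/
def tridiag {R : Type*} [CommRing R] (U β D : ℕ → R) (φ : ℕ → R) : ℕ → R
  | 0 => U 0 * φ 1 + β 0 * φ 0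
  | h + 1 => U (h + 1) * φ (h + 2) + β (h + 1) * φ (h + 1) + D h * φ h

/-- The generating function of the weighted paths from height `h` to height `0`. -/
noncomputable def pathSeries {R : Type*} [CommRing R] (U β D : ℕ → R) (h : ℕ) : PowerSeries R :=
  PowerSeries.mk fun n => (tridiag U β D)^[n] (Pi.single 0 1) h

/-! ### J-fractions as generating functions of weighted Motzkin paths -/

section JFraction

open PowerSeries

variable {R : Type*} [CommRing R] (U β D : ℕ → R)

theorem pathSeries_zero :
    pathSeries U β D 0 =
      1 + X * (C (U 0) * pathSeries U β D 1 + C (β 0) * pathSeries U β D 0) := by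
  ext n
  cases n with
  | zero => simp [pathSeries]
  | succ n =>
    simp [pathSeries, coeff_succ_X_mul, coeff_one, Function.iterate_succ_apply', tridiag]

theorem pathSeries_succ (h : ℕ) :
    pathSeries U β D (h + 1) =
      X * (C (U (h + 1)) * pathSeries U β D (h + 2) + C (β (h + 1)) * pathSeries U β D (h + 1) +
        C (D h) * pathSeries U β D h) := by
  ext n
  cases n with
  | zero => simp [pathSeries]
  | succ n =>
    simp [pathSeries, coeff_succ_X_mul, Function.iterate_succ_apply', tridiag]

/-- A path from `h + 1` to 0 splits at its first step down to `h`: what precedes that step stays at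
height at least `h + 1` and is counted by the J-fraction starting there. Each level of the
convergent gains a factor `X`; at depth 0 the convergent is 0, and the path has at least one step.
-/
theorem X_pow_dvd_pathSeries_succ_sub (γ : ℕ → R) (hγ : ∀ h, γ (h + 1) = U h * D h) (m h : ℕ) :
    X ^ (m + 1) ∣ pathSeries U β D (h + 1) -
      X * C (D h) * jConvergent β γ m (h + 1) * pathSeries U β D h := by
  induction m generalizing h with
  | zero =>
    rw [pathSeries_succ]
    simp only [jConvergent, mul_zero, zero_mul, sub_zero, zero_add, pow_one]
    exact dvd_mul_right _ _
  | succ m ih =>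
    obtain ⟨e, he⟩ := ih (h + 1)
    have h1 := pathSeries_succ U β D h
    have h2 := denom_mul_jStep (β (h + 1)) (γ (h + 1 + 1)) (jConvergent β γ m (h + 1 + 1))
    rw [hγ, map_mul] at h2
    -- The recursion, with the induction hypothesis put in for height `h + 2`, has exactly the
    -- denominator of `J` in front of the series at `h + 1`; multiplying by `J` clears it, and the
    -- old error picks up `X * U (h + 1) * J`.
    refine ⟨C (U (h + 1)) * e * jConvergent β γ (m + 1) (h + 1), ?_⟩
    simp only [jConvergent]
    rw [hγ]
    set J := jStep (β (h + 1)) (U (h + 1) * D (h + 1)) (jConvergent β γ m (h + 1 + 1))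
    linear_combination (J) * h1 + (X * C (U (h + 1)) * J) * he -
      pathSeries U β D (h + 1) * h2

theorem X_pow_dvd_pathSeries_zero_sub (γ : ℕ → R) (hγ : ∀ h, γ (h + 1) = U h * D h) (m : ℕ) :
    X ^ (m + 2) ∣ pathSeries U β D 0 - jConvergent β γ (m + 1) 0 := by
  obtain ⟨e, he⟩ := X_pow_dvd_pathSeries_succ_sub U β D γ hγ m 0
  have h1 := pathSeries_zero U β D
  have h2 := denom_mul_jStep (β 0) (γ (0 + 1)) (jConvergent β γ m (0 + 1))
  rw [hγ, map_mul] at h2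
  refine ⟨C (U 0) * e * jConvergent β γ (m + 1) 0, ?_⟩
  simp only [jConvergent]
  rw [hγ]
  set J := jStep (β 0) (U 0 * D 0) (jConvergent β γ m (0 + 1))
  simp only [zero_add] at *
  linear_combination J * h1 + (X * C (U 0) * J) * he - pathSeries U β D 0 * h2

theorem isJFraction_pathSeries (γ : ℕ → R) (hγ : ∀ h, γ (h + 1) = U h * D h) :
    IsJFraction β γ (pathSeries U β D 0) := by
  intro n
  filter_upwards [eventually_ge_atTop (n + 1)] with m hm
  obtain ⟨m, rfl⟩ : ∃ k, m = k + 1 := ⟨m - 1, by omega⟩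
  have h := (X_pow_dvd_iff.1 (X_pow_dvd_pathSeries_zero_sub U β D γ hγ m)) n (by omega)
  rw [map_sub, sub_eq_zero] at h
  exact h.symm

end JFraction

/-! ### Words with gaps and the insertion of letters -/

/-- The pairs `(L, R)` with `d = L ++ N :: R`. -/
def splits (N : ℕ) : List ℕ → List (List ℕ × List ℕ)
  | [] => []
  | x :: l => (if x = N then [([], l)] else []) ++ (splits N l).map fun s => (x :: s.1, s.2)

theorem mem_splits {N : ℕ} {d : List ℕ} {s : List ℕ × List ℕ} :
    s ∈ splits N d ↔ d = s.1 ++ N :: s.2 := by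
  induction d generalizing s with
  | nil => simp [splits]
  | cons x l ih =>
    obtain ⟨L, R⟩ := s
    cases L with
    | nil => simp [splits, eq_comm (a := l)]
    | cons y L =>
      have : ∀ P : Prop, ((y :: L, R) ∈ (if x = N then [(([] : List ℕ), l)] else [])) ↔ False := by
        intro _; split_ifs <;> simp
      simp only [splits, List.mem_append, this True, List.mem_map, false_or, Prod.exists,
        Prod.mk.injEq, List.cons.injEq, List.cons_append]
      constructor
      · rintro ⟨A, B, h, ⟨rfl, rfl⟩, rfl⟩
        exact ⟨rfl, ih.1 h⟩
      · rintro ⟨rfl, h⟩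
        exact ⟨L, R, ih.2 h, ⟨rfl, rfl⟩, rfl⟩

theorem nodup_splits (N : ℕ) (d : List ℕ) : (splits N d).Nodup := by
  induction d with
  | nil => simp [splits]
  | cons x l ih =>
    rw [splits, List.nodup_append]
    refine ⟨by split_ifs <;> simp, ih.map ?_, ?_⟩
    · rintro ⟨a, b⟩ ⟨c, d⟩ h
      simpa using h
    · intro a ha b hb
      split_ifs at ha
      · simp only [List.mem_singleton] at ha
        subst ha
        simp only [List.mem_map] at hb
        obtain ⟨s, -, rfl⟩ := hb
        simp
      · simp at ha

/-- The cuts correspond to the numbers `i` of gaps on the left, each value below the total occurring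
once. Sums over insertions thereby become sums over `i`. -/
theorem sum_splits {M : Type*} [AddCommMonoid M] (N : ℕ) (f : ℕ → ℕ → M) (d : List ℕ) :
    ((splits N d).map fun s => f (s.1.count N) (s.2.count N)).sum =
      ∑ i ∈ Finset.range (d.count N), f i (d.count N - 1 - i) := by
  induction d generalizing f with
  | nil => simp [splits]
  | cons x l ih =>
    rw [splits, List.map_append, List.sum_append, List.map_map]
    by_cases hx : x = N
    · subst hx
      have := ih fun i j => f (i + 1) j
      simp only [Function.comp_def, List.count_cons_self, if_true, List.map_cons, List.map_nil,
        List.count_nil, List.sum_cons, List.sum_nil, add_zero, this, Finset.sum_range_succ',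
        Nat.add_sub_cancel, Nat.sub_zero]
      rw [add_comm]
      congr 1
      refine Finset.sum_congr rfl fun i hi => ?_
      congr 1
      omega
    · have := ih f
      simp only [Function.comp_def, List.count_cons_of_ne hx, if_neg hx, List.map_nil,
        List.sum_nil, zero_add, this]

/-- Consecutive letters form an ascent or an even-odd descent. -/
def StepRel (x y : ℕ) : Prop := x < y ∨ (y < x ∧ Even x ∧ Odd y)

theorem StepRel.ne {x y : ℕ} (h : StepRel x y) : x ≠ y := by
  rcases h with h | h <;> omega

/-- A word on `{1, …, k}` cut into blocks by the letter `N`, which stands for a nonempty run of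
letters greater than `k` and also ends the word. -/
structure IsBlockWord (N k : ℕ) (d : List ℕ) : Prop where
  chain : d.IsChain StepRel
  last : ∃ s, d = s ++ [N]
  mem : ∀ x ∈ d, x = N ∨ (1 ≤ x ∧ x ≤ k)
  count : ∀ v, 1 ≤ v → v ≤ k → d.count v = 1

/-- Put `v` at the end of a block. -/
def appendLetter (N v : ℕ) (s : List ℕ × List ℕ) : List ℕ := s.1 ++ v :: N :: s.2

/-- Make `v` a block of its own. -/
def newLetter (N v : ℕ) (s : List ℕ × List ℕ) : List ℕ := s.1 ++ N :: v :: N :: s.2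

/-- Join two blocks by `v`. -/
def joinLetter (v : ℕ) (s : List ℕ × List ℕ) : List ℕ := s.1 ++ v :: s.2

/-- The ways to insert the odd letter `v`. -/
def insertOdd (N v : ℕ) (d : List ℕ) : List (List ℕ) :=
  (splits N d).map (appendLetter N v) ++ (splits N d).map (newLetter N v)

/-- The ways to insert the even letter `v`. -/
def insertEven (N v : ℕ) (d : List ℕ) : List (List ℕ) :=
  (splits N d).map (appendLetter N v) ++
    ((splits N d).filter fun s => s.2 ≠ []).map (joinLetter v)

/-- The words with letters `1, …, 2j` and gaps. -/
def blockWords (N : ℕ) : ℕ → List (List ℕ)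
  | 0 => [[N]]
  | j + 1 => ((blockWords N j).flatMap (insertOdd N (2 * j + 1))).flatMap
      (insertEven N (2 * j + 2))

theorem append_cons_inj {v : ℕ} {L L' R R' : List ℕ} (h : v ∉ L) (h' : v ∉ L')
    (e : L ++ v :: R = L' ++ v :: R') : L = L' ∧ R = R' := by
  induction L generalizing L' with
  | nil =>
    cases L' with
    | nil => simpa using e
    | cons x L' => simp at e h'; exact absurd e.1 h'.1
  | cons y L ih =>
    cases L' with
    | nil => simp at e h; exact absurd e.1.symm h.1
    | cons x L' =>
      simp only [List.cons_append, List.cons.injEq, List.mem_cons, not_or] at e h h'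
      obtain ⟨h1, h2⟩ := ih h.2 h'.2 e.2
      exact ⟨by rw [e.1, h1], h2⟩

/-! ### Insertions produce exactly the block words -/

section Insert

variable {N k : ℕ} {d : List ℕ} {s : List ℕ × List ℕ}

/-- Facts about a cut of a block word at a gap. -/
theorem IsBlockWord.cut {L R : List ℕ} (hd : IsBlockWord N k (L ++ N :: R)) :
    L.IsChain StepRel ∧ R.IsChain StepRel ∧ (∀ x ∈ L.getLast?, x ≠ N ∧ 1 ≤ x ∧ x ≤ k) ∧
      (∀ x ∈ R.head?, StepRel N x ∧ x ≠ N ∧ 1 ≤ x ∧ x ≤ k) ∧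
      (R = [] ∨ ∃ s, R = s ++ [N]) := by
  have h := hd.chain
  rw [List.isChain_append, List.isChain_cons] at h
  obtain ⟨h1, ⟨h2, h3⟩, h4⟩ := h
  refine ⟨h1, h3, ?_, ?_, ?_⟩
  · intro x hx
    have hne := (h4 x hx N (by simp)).ne
    refine ⟨hne, (hd.mem x ?_).resolve_left hne⟩
    simp [List.mem_of_getLast? hx]
  · intro x hx
    have hne := (h2 x hx).ne.symm
    refine ⟨h2 x hx, hne, (hd.mem x ?_).resolve_left hne⟩
    simp [List.mem_of_head? hx]
  · rcases R.eq_nil_or_concat with h | ⟨s, x, rfl⟩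
    · exact Or.inl h
    · right
      obtain ⟨t, ht⟩ := hd.last
      have h : (L ++ N :: s) ++ [x] = t ++ [N] := by simpa using ht
      have := (List.append_inj' h rfl).2
      exact ⟨s, by simpa using this⟩

theorem IsBlockWord.notMem (hd : IsBlockWord N k d) (hN : k + 1 < N) : k + 1 ∉ d := fun h => by
  rcases hd.mem _ h with h | h <;> omega

/-- Common part of the three insertions, with `X` one of `[v, N]`, `[N, v, N]`, `[v]`. The step from
`L` into `X` needs no hypothesis: no gap precedes a gap, so `L` ends in a letter at most `k` and the
step is an ascent. -/
theorem isBlockWord_of_surround {L X R : List ℕ} (hd : IsBlockWord N k (L ++ N :: R))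
    (hN : k + 1 < N) (hX : ∀ x ∈ X, x = N ∨ x = k + 1) (hc : X.count (k + 1) = 1)
    (hchain : X.IsChain StepRel) (hhead : ∀ y ∈ X.head?, y = N ∨ y = k + 1)
    (hlast : ∀ x ∈ X.getLast?, ∀ y ∈ R.head?, StepRel x y)
    (hend : R = [] → ∃ s, X = s ++ [N]) : IsBlockWord N (k + 1) (L ++ (X ++ R)) := by
  obtain ⟨h1, h2, h3, h4, h5⟩ := hd.cut
  have hXne : X ≠ [] := by rintro rfl; simp at hc
  refine ⟨?_, ?_, ?_, ?_⟩
  · rw [List.isChain_append, List.isChain_append]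
    refine ⟨h1, ⟨hchain, h2, hlast⟩, ?_⟩
    intro x hx y hy
    have h6 := h3 x hx
    have hy' : y ∈ X.head? := by
      rw [List.head?_append] at hy
      cases X with
      | nil => exact absurd rfl hXne
      | cons z X => simpa using hy
    left
    rcases hhead y hy' with h | h <;> omega
  · rcases h5 with h | ⟨s, h⟩
    · obtain ⟨s, hs⟩ := hend h
      exact ⟨L ++ s, by simp [h, hs]⟩
    · exact ⟨L ++ (X ++ s), by simp [h]⟩
  · intro x hx
    have := hd.mem x
    simp only [List.mem_append, List.mem_cons] at hx this
    rcases hx with h | h | h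
    · have := this (Or.inl h); omega
    · have := hX x h; omega
    · have := this (Or.inr (Or.inr h)); omega
  · intro v hv hv'
    rcases Nat.lt_or_ge k v with h | h
    · obtain rfl : v = k + 1 := by omega
      have := hd.notMem hN
      simp only [List.mem_append, List.mem_cons, not_or] at this
      rw [List.count_append, List.count_append, hc, List.count_eq_zero_of_not_mem this.1,
        List.count_eq_zero_of_not_mem this.2.2]
    · have h6 := hd.count v hv h
      have h7 : X.count v = 0 := List.count_eq_zero_of_not_mem fun h => by
        have := hX v h; omega
      rw [List.count_append, List.count_cons_of_ne (by omega)] at h6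
      rw [List.count_append, List.count_append, h7]
      omega

theorem isBlockWord_appendLetter {L R : List ℕ} (hd : IsBlockWord N k (L ++ N :: R))
    (hN : k + 1 < N) : IsBlockWord N (k + 1) (appendLetter N (k + 1) (L, R)) := by
  refine isBlockWord_of_surround (X := [k + 1, N]) hd hN (by simp) ?_ ?_ (by simp) ?_ ?_
  · rw [List.count_cons_self, List.count_cons_of_ne (by omega)]; simp
  · simp [StepRel, hN]
  · intro x hx y hy
    obtain rfl : x = N := by simpa [eq_comm] using hx
    exact (hd.cut.2.2.2.1 y hy).1
  · exact fun _ => ⟨[k + 1], rfl⟩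

theorem isBlockWord_newLetter {L R : List ℕ} (hd : IsBlockWord N k (L ++ N :: R))
    (hN : k + 1 < N) (hNe : Even N) (ho : Odd (k + 1)) :
    IsBlockWord N (k + 1) (newLetter N (k + 1) (L, R)) := by
  refine isBlockWord_of_surround (X := [N, k + 1, N]) hd hN (by simp) ?_ ?_ (by simp) ?_ ?_
  · rw [List.count_cons_of_ne (by omega), List.count_cons_self, List.count_cons_of_ne (by omega)]
    simp
  · simp [StepRel, hN, hNe, ho]
  · intro x hx y hy
    obtain rfl : x = N := by simpa [eq_comm] using hx
    exact (hd.cut.2.2.2.1 y hy).1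
  · exact fun _ => ⟨[N, k + 1], rfl⟩

/-- The letter after a gap is a descent bottom, hence odd, so the even `k + 1` may take the place of
the gap as descent top. -/
theorem isBlockWord_joinLetter {L R : List ℕ} (hd : IsBlockWord N k (L ++ N :: R))
    (hN : k + 1 < N) (he : Even (k + 1)) (hR : R ≠ []) :
    IsBlockWord N (k + 1) (joinLetter (k + 1) (L, R)) := by
  refine isBlockWord_of_surround (X := [k + 1]) hd hN (by simp) (by simp) (by simp) (by simp)
    ?_ (fun h => absurd h hR)
  intro x hx y hy
  obtain rfl : x = k + 1 := by simpa [eq_comm] using hx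
  have := hd.cut.2.2.2.1 y hy
  right
  refine ⟨by omega, he, ?_⟩
  rcases this.1 with h | h
  · omega
  · exact h.2.2

/-- Cutting a block word at its largest letter. -/
theorem IsBlockWord.exists_cut (hd : IsBlockWord N (k + 1) d) (hN : k + 1 < N) :
    ∃ L x R, d = L ++ (k + 1) :: x :: R ∧ k + 1 ∉ L ∧ k + 1 ∉ x :: R ∧
      StepRel (k + 1) x ∧ (∀ y ∈ L.getLast?, StepRel y (k + 1)) := by
  have hmem : k + 1 ∈ d := List.count_pos_iff.1 (by rw [hd.count _ (by omega) le_rfl]; omega)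
  obtain ⟨L, R, rfl⟩ := List.append_of_mem hmem
  have hc := hd.count _ (by omega) le_rfl
  rw [List.count_append, List.count_cons_self] at hc
  have hL : k + 1 ∉ L := List.count_eq_zero.1 (by omega)
  have hR : k + 1 ∉ R := List.count_eq_zero.1 (by omega)
  cases R with
  | nil =>
    obtain ⟨s, hs⟩ := hd.last
    have := congrArg List.getLast? hs
    simp at this
    omega
  | cons x R =>
    have h := hd.chain
    rw [List.isChain_append, List.isChain_cons] at h
    exact ⟨L, x, R, rfl, hL, hR, h.2.1.1 x (by simp), fun y hy => h.2.2 y hy _ (by simp)⟩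

/-- Converse of `isBlockWord_of_surround`: `X` shrinks back to a gap. The hypotheses on the
neighbours forbid adjacent gaps and make the step out of the gap an even-odd descent. -/
theorem IsBlockWord.of_cut {L R X : List ℕ} (hd : IsBlockWord N (k + 1) (L ++ (X ++ R)))
    (hN : k + 1 < N) (hNe : Even N) (hX : ∀ x ∈ X, x = N ∨ x = k + 1) (hL : k + 1 ∉ L)
    (hLN : ∀ x ∈ L.getLast?, x ≠ N) (hR : k + 1 ∉ R) (hRN : ∀ x ∈ R.head?, x ≠ N ∧ Odd x)
    (hend : R = [] → N ∈ X) : IsBlockWord N k (L ++ N :: R) := by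
  have h := hd.chain
  rw [List.isChain_append, List.isChain_append] at h
  have hm : ∀ x ∈ L ++ (X ++ R), x ≤ N := fun x hx => by
    rcases hd.mem x hx with h | h <;> omega
  refine ⟨?_, ?_, ?_, ?_⟩
  · rw [List.isChain_append, List.isChain_cons]
    refine ⟨h.1, ⟨?_, h.2.1.2.1⟩, ?_⟩
    · intro y hy
      have h1 := hRN y hy
      have h2 := hm y (by simp [List.mem_of_head? hy])
      exact Or.inr ⟨by omega, hNe, h1.2⟩
    · intro x hx y hy
      obtain rfl : N = y := by simpa using hy
      have h1 := hLN x hx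
      have h2 := hm x (by simp [List.mem_of_getLast? hx])
      exact Or.inl (by omega)
  · rcases R.eq_nil_or_concat with h | ⟨s, x, rfl⟩
    · exact ⟨L, by simp [h]⟩
    · obtain ⟨t, ht⟩ := hd.last
      have := congrArg List.getLast? ht
      simp at this
      exact ⟨L ++ N :: s, by simp [this]⟩
  · intro x hx
    simp only [List.mem_append, List.mem_cons] at hx
    have h1 := hd.mem x
    simp only [List.mem_append] at h1
    rcases hx with h | h | h
    · have : x ≠ k + 1 := fun e => hL (e ▸ h)
      have := h1 (Or.inl h)
      omega
    · exact Or.inl h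
    · have : x ≠ k + 1 := fun e => hR (e ▸ h)
      have := h1 (Or.inr (Or.inr h))
      omega
  · intro v hv hv'
    have h1 := hd.count v hv (by omega)
    have h2 : X.count v = 0 := List.count_eq_zero_of_not_mem fun h => by
      have := hX v h; omega
    rw [List.count_append, List.count_append, h2] at h1
    rw [List.count_append, List.count_cons_of_ne (by omega)]
    omega

/-- An odd letter cannot be a descent top, and only `N` exceeds it, so `N` follows. Whether `N` also
precedes it tells which insertion was used. -/
theorem IsBlockWord.mem_insertOdd (hd : IsBlockWord N (k + 1) d) (hN : k + 1 < N)
    (hNe : Even N) (ho : Odd (k + 1)) : ∃ c, IsBlockWord N k c ∧ d ∈ insertOdd N (k + 1) c := by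
  obtain ⟨L, x, R, rfl, hL, hR, hx, hy⟩ := hd.exists_cut hN
  have hxN : x = N := by
    rcases hx with h | h
    · rcases hd.mem x (by simp) with h' | h' <;> omega
    · exact absurd h.2.1 (Nat.not_even_iff_odd.2 ho)
  subst hxN
  simp only [List.mem_cons, not_or] at hR
  have hRc : ∀ y ∈ R.head?, y ≠ x ∧ Odd y := by
    have h := hd.chain
    rw [List.isChain_append, List.isChain_cons, List.isChain_cons] at h
    intro y hy
    have h1 := h.2.1.2.1 y hy
    refine ⟨h1.ne.symm, ?_⟩
    rcases h1 with h | h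
    · rcases hd.mem y (by simp [List.mem_of_head? hy]) with h' | h' <;> omega
    · exact h.2.2
  by_cases hlast : x ∈ L.getLast?
  · obtain ⟨L', rfl⟩ : ∃ L', L = L' ++ [x] := by
      rcases L.eq_nil_or_concat with h | ⟨s, z, rfl⟩
      · simp [h] at hlast
      · simp at hlast; exact ⟨s, by simp [hlast]⟩
    refine ⟨L' ++ x :: R, ?_, ?_⟩
    · simp only [List.append_assoc] at hd
      refine IsBlockWord.of_cut (X := [x, k + 1, x]) (by simpa using hd) hN hNe (by simp)
        (fun h => hL (by simp [h])) ?_ hR.2 hRc (by simp)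
      have h := hd.chain
      rw [List.isChain_append] at h
      intro z hz
      exact (h.2.2 z hz x (by simp)).ne
    · exact List.mem_append_right _ (List.mem_map.2 ⟨(L', R), mem_splits.2 rfl, by
        simp [newLetter]⟩)
  · refine ⟨L ++ x :: R, ?_, ?_⟩
    · exact IsBlockWord.of_cut (X := [k + 1, x]) (by simpa using hd) hN hNe (by simp) hL
        (fun z hz e => hlast (e ▸ hz)) hR.2 hRc (by simp)
    · exact List.mem_append_left _ (List.mem_map.2 ⟨(L, R), mem_splits.2 rfl, rfl⟩)

/-- An even letter cannot be a descent bottom, so no gap precedes it. Whether a gap follows it tells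
which insertion was used. -/
theorem IsBlockWord.mem_insertEven (hd : IsBlockWord N (k + 1) d) (hN : k + 1 < N)
    (hNe : Even N) (he : Even (k + 1)) : ∃ c, IsBlockWord N k c ∧ d ∈ insertEven N (k + 1) c := by
  obtain ⟨L, x, R, rfl, hL, hR, hx, hy⟩ := hd.exists_cut hN
  have hLN : ∀ z ∈ L.getLast?, z ≠ N := by
    rintro z hz rfl
    rcases hy z hz with h | h
    · omega
    · exact absurd he (Nat.not_even_iff_odd.2 h.2.2)
  by_cases hxN : x = N
  · subst hxN
    simp only [List.mem_cons, not_or] at hR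
    have hRc : ∀ y ∈ R.head?, y ≠ x ∧ Odd y := by
      have h := hd.chain
      rw [List.isChain_append, List.isChain_cons, List.isChain_cons] at h
      intro y hy
      have h1 := h.2.1.2.1 y hy
      refine ⟨h1.ne.symm, ?_⟩
      rcases h1 with h | h
      · rcases hd.mem y (by simp [List.mem_of_head? hy]) with h' | h' <;> omega
      · exact h.2.2
    exact ⟨L ++ x :: R, IsBlockWord.of_cut (X := [k + 1, x]) (by simpa using hd) hN hNe (by simp)
        hL hLN hR.2 hRc (by simp),
      List.mem_append_left _ (List.mem_map.2 ⟨(L, R), mem_splits.2 rfl, rfl⟩)⟩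
  · refine ⟨L ++ N :: x :: R, IsBlockWord.of_cut (X := [k + 1]) (by simpa using hd) hN hNe
      (by simp) hL hLN hR ?_ (by simp), List.mem_append_right _ (List.mem_map.2
        ⟨(L, x :: R), List.mem_filter.2 ⟨mem_splits.2 rfl, by simp⟩, rfl⟩)⟩
    intro z hz
    obtain rfl : x = z := by simpa using hz
    refine ⟨hxN, ?_⟩
    rcases hx with h | h
    · rcases hd.mem x (by simp) with h' | h' <;> omega
    · exact h.2.2

theorem isBlockWord_of_mem_insertOdd {c : List ℕ} (hc : IsBlockWord N k c) (hN : k + 1 < N)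
    (hNe : Even N) (ho : Odd (k + 1)) (h : d ∈ insertOdd N (k + 1) c) :
    IsBlockWord N (k + 1) d := by
  rw [insertOdd, List.mem_append, List.mem_map, List.mem_map] at h
  rcases h with ⟨⟨L, R⟩, hs, rfl⟩ | ⟨⟨L, R⟩, hs, rfl⟩ <;> rw [mem_splits.1 hs] at hc
  · exact isBlockWord_appendLetter hc hN
  · exact isBlockWord_newLetter hc hN hNe ho

theorem isBlockWord_of_mem_insertEven {c : List ℕ} (hc : IsBlockWord N k c) (hN : k + 1 < N)
    (he : Even (k + 1)) (h : d ∈ insertEven N (k + 1) c) :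
    IsBlockWord N (k + 1) d := by
  rw [insertEven, List.mem_append, List.mem_map, List.mem_map] at h
  rcases h with ⟨⟨L, R⟩, hs, rfl⟩ | ⟨⟨L, R⟩, hs, rfl⟩
  · rw [mem_splits.1 hs] at hc
    exact isBlockWord_appendLetter hc hN
  · rw [List.mem_filter] at hs
    rw [mem_splits.1 hs.1] at hc
    exact isBlockWord_joinLetter hc hN he (by simpa using hs.2)

end Insert

/-! ### Removal of the largest letter; each word is generated once -/

/-- The part of `d` before the first occurrence of `v`. -/
def before (v : ℕ) (d : List ℕ) : List ℕ := d.takeWhile (· ≠ v)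

/-- The part of `d` after the first occurrence of `v`. -/
def after (v : ℕ) (d : List ℕ) : List ℕ := (d.dropWhile (· ≠ v)).tail

theorem before_cons_self (v : ℕ) (d : List ℕ) : before v (v :: d) = [] := by simp [before]

theorem after_cons_self (v : ℕ) (d : List ℕ) : after v (v :: d) = d := by simp [after]

theorem before_append {v : ℕ} {l : List ℕ} (h : v ∉ l) (r : List ℕ) :
    before v (l ++ r) = l ++ before v r := by
  induction l with
  | nil => rfl
  | cons x l ih =>
    simp only [List.mem_cons, not_or] at h
    have := ih h.2
    simp only [before] at this ⊢
    simpa [Ne.symm h.1] using this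

theorem after_append {v : ℕ} {l : List ℕ} (h : v ∉ l) (r : List ℕ) :
    after v (l ++ r) = after v r := by
  induction l with
  | nil => rfl
  | cons x l ih =>
    simp only [List.mem_cons, not_or] at h
    have := ih h.2
    simp only [after] at this ⊢
    simpa [Ne.symm h.1] using this

theorem before_append_cons {v : ℕ} {l : List ℕ} (h : v ∉ l) (r : List ℕ) :
    before v (l ++ v :: r) = l := by
  rw [before_append h, before_cons_self, List.append_nil]

theorem after_append_cons {v : ℕ} {l : List ℕ} (h : v ∉ l) (r : List ℕ) :
    after v (l ++ v :: r) = r := by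
  rw [after_append h, after_cons_self]

/-- Undo the insertion of `v`. -/
def removeLetter (N v : ℕ) (d : List ℕ) : List ℕ :=
  (if (before v d).getLast? = some N then (before v d).dropLast else before v d) ++
    (if (after v d).head? = some N then after v d else N :: after v d)

section Insert

variable {N k : ℕ} {c d : List ℕ}

theorem IsBlockWord.cut_facts {L R : List ℕ} (hc : IsBlockWord N k (L ++ N :: R))
    (hN : k + 1 < N) : k + 1 ∉ L ∧ k + 1 ∉ R ∧ L.getLast? ≠ some N ∧ R.head? ≠ some N := by
  have h := hc.notMem hN
  simp only [List.mem_append, List.mem_cons, not_or] at h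
  obtain ⟨-, -, h3, h4, -⟩ := hc.cut
  exact ⟨h.1, h.2.2, fun e => (h3 N e).1 rfl, fun e => (h4 N e).2.1 rfl⟩

/-- Adjacent gaps do not occur, so a gap directly before the letter comes from `newLetter`, and one
gap has to remain in its place. This recovers the parent, hence different parents have no child in
common. -/
theorem removeLetter_of_mem_insertOdd (hc : IsBlockWord N k c) (hN : k + 1 < N)
    (h : d ∈ insertOdd N (k + 1) c) : removeLetter N (k + 1) d = c := by
  rw [insertOdd, List.mem_append, List.mem_map, List.mem_map] at h
  rcases h with ⟨⟨L, R⟩, hs, rfl⟩ | ⟨⟨L, R⟩, hs, rfl⟩ <;> obtain rfl := mem_splits.1 hs <;>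
    obtain ⟨h1, h2, h3, h4⟩ := hc.cut_facts hN
  · simp [removeLetter, appendLetter, before_append_cons h1, after_append_cons h1, h3]
  · have h5 : k + 1 ∉ L ++ [N] := by simp [h1]; omega
    have : newLetter N (k + 1) (L, R) = (L ++ [N]) ++ (k + 1) :: N :: R := by simp [newLetter]
    rw [this]
    simp only [removeLetter, before_append_cons h5, after_append_cons h5]
    simp

theorem removeLetter_of_mem_insertEven (hc : IsBlockWord N k c) (hN : k + 1 < N)
    (h : d ∈ insertEven N (k + 1) c) : removeLetter N (k + 1) d = c := by
  rw [insertEven, List.mem_append, List.mem_map, List.mem_map] at h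
  rcases h with ⟨⟨L, R⟩, hs, rfl⟩ | ⟨⟨L, R⟩, hs, rfl⟩
  · obtain rfl := mem_splits.1 hs
    obtain ⟨h1, h2, h3, h4⟩ := hc.cut_facts hN
    simp [removeLetter, appendLetter, before_append_cons h1, after_append_cons h1, h3]
  · obtain rfl := mem_splits.1 (List.mem_filter.1 hs).1
    obtain ⟨h1, h2, h3, h4⟩ := hc.cut_facts hN
    simp [removeLetter, joinLetter, before_append_cons h1, after_append_cons h1, h3, h4]

theorem nodup_insertOdd (hc : IsBlockWord N k c) (hN : k + 1 < N) :
    (insertOdd N (k + 1) c).Nodup := by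
  have hinj : ∀ f : List ℕ × List ℕ → List ℕ,
      (∀ L R L' R', k + 1 ∉ L → k + 1 ∉ L' → f (L, R) = f (L', R') → L = L' ∧ R = R') →
      ((splits N c).map f).Nodup := by
    intro f hf
    refine (List.nodup_map_iff_inj_on (nodup_splits N c)).2 ?_
    rintro ⟨L, R⟩ h ⟨L', R'⟩ h' e
    have h1 := (IsBlockWord.cut_facts (mem_splits.1 h ▸ hc) hN).1
    have h2 := (IsBlockWord.cut_facts (mem_splits.1 h' ▸ hc) hN).1
    obtain ⟨rfl, rfl⟩ := hf L R L' R' h1 h2 e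
    rfl
  rw [insertOdd, List.nodup_append]
  refine ⟨hinj _ ?_, hinj _ ?_, ?_⟩
  · intro L R L' R' h h' e
    simpa using append_cons_inj h h' e
  · intro L R L' R' h h' e
    have e' : (L ++ [N]) ++ (k + 1) :: N :: R = (L' ++ [N]) ++ (k + 1) :: N :: R' := by
      simpa [newLetter] using e
    simpa using append_cons_inj (by simp [h]; omega) (by simp [h']; omega) e'
  -- The two families are disjoint: only `newLetter` puts a gap directly before the letter.
  · intro x hx y hy e
    rw [List.mem_map] at hx hy
    obtain ⟨⟨L, R⟩, h, rfl⟩ := hx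
    obtain ⟨⟨L', R'⟩, h', rfl⟩ := hy
    have h1 := IsBlockWord.cut_facts (mem_splits.1 h ▸ hc) hN
    have h2 := IsBlockWord.cut_facts (mem_splits.1 h' ▸ hc) hN
    have e' : L ++ (k + 1) :: N :: R = (L' ++ [N]) ++ (k + 1) :: N :: R' := by
      simpa [newLetter, appendLetter] using e
    have h3 := (append_cons_inj h1.1 (by simp [h2.1]; omega) e').1
    apply h1.2.2.1
    simp only at h3 ⊢
    rw [h3]
    simp

theorem nodup_insertEven (hc : IsBlockWord N k c) (hN : k + 1 < N) :
    (insertEven N (k + 1) c).Nodup := by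
  rw [insertEven, List.nodup_append]
  refine ⟨?_, ?_, ?_⟩
  · refine (List.nodup_map_iff_inj_on (nodup_splits N c)).2 ?_
    rintro ⟨L, R⟩ h ⟨L', R'⟩ h' e
    have h1 := (IsBlockWord.cut_facts (mem_splits.1 h ▸ hc) hN).1
    have h2 := (IsBlockWord.cut_facts (mem_splits.1 h' ▸ hc) hN).1
    simpa using append_cons_inj h1 h2 e
  · refine (List.nodup_map_iff_inj_on ((nodup_splits N c).filter _)).2 ?_
    rintro ⟨L, R⟩ h ⟨L', R'⟩ h' e
    have h1 := (IsBlockWord.cut_facts (mem_splits.1 (List.mem_filter.1 h).1 ▸ hc) hN).1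
    have h2 := (IsBlockWord.cut_facts (mem_splits.1 (List.mem_filter.1 h').1 ▸ hc) hN).1
    simpa using append_cons_inj h1 h2 e
  -- The two families are disjoint: only `appendLetter` leaves a gap directly after the letter.
  · intro x hx y hy e
    rw [List.mem_map] at hx hy
    obtain ⟨⟨L, R⟩, h, rfl⟩ := hx
    obtain ⟨⟨L', R'⟩, h', rfl⟩ := hy
    have h1 := IsBlockWord.cut_facts (mem_splits.1 h ▸ hc) hN
    have h2 := IsBlockWord.cut_facts (mem_splits.1 (List.mem_filter.1 h').1 ▸ hc) hN
    have h3 := (append_cons_inj h1.1 h2.1 e).2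
    apply h2.2.2.2
    simp only at h3 ⊢
    rw [← h3]
    simp

theorem nodup_flatMap_of_leftInverse {α β : Type*} {l : List α} {f : α → List β} (g : β → α)
    (hl : l.Nodup) (hf : ∀ x ∈ l, (f x).Nodup) (hg : ∀ x ∈ l, ∀ y ∈ f x, g y = x) :
    (l.flatMap f).Nodup := by
  rw [List.nodup_flatMap]
  refine ⟨hf, ?_⟩
  refine List.Pairwise.imp_of_mem ?_ hl
  intro x x' hx hx' hne y hy hy'
  exact hne ((hg x hx y hy).symm.trans (hg x' hx' y hy'))

theorem mem_flatMap_insertOdd (hNe : Even N) {j : ℕ} (hN : 2 * j + 1 < N) {l : List (List ℕ)}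
    (hl : ∀ d, d ∈ l ↔ IsBlockWord N (2 * j) d) :
    d ∈ l.flatMap (insertOdd N (2 * j + 1)) ↔ IsBlockWord N (2 * j + 1) d := by
  rw [List.mem_flatMap]
  constructor
  · rintro ⟨c, hc, h⟩
    exact isBlockWord_of_mem_insertOdd ((hl c).1 hc) hN hNe ⟨j, rfl⟩ h
  · intro h
    obtain ⟨c, hc, h⟩ := h.mem_insertOdd hN hNe ⟨j, rfl⟩
    exact ⟨c, (hl c).2 hc, h⟩

theorem mem_blockWords (hNe : Even N) (j : ℕ) (hN : 2 * j < N) :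
    d ∈ blockWords N j ↔ IsBlockWord N (2 * j) d := by
  induction j generalizing d with
  | zero =>
    simp only [blockWords, List.mem_singleton]
    constructor
    · rintro rfl
      exact ⟨by simp, ⟨[], rfl⟩, by simp, fun v h h' => by omega⟩
    · intro h
      have hm : ∀ x ∈ d, x = N := fun x hx => by
        rcases h.mem x hx with h | h <;> omega
      obtain ⟨s, rfl⟩ := h.last
      -- Without letters, a longer word would contain two adjacent gaps.
      rcases s.eq_nil_or_concat with h' | ⟨s, x, rfl⟩
      · simp [h']
      · have h1 := h.chain
        rw [List.isChain_append] at h1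
        exact absurd (hm x (by simp)) (h1.2.2 x (by simp) N (by simp)).ne
  | succ j ih =>
    have h1 : ∀ d, d ∈ blockWords N j ↔ IsBlockWord N (2 * j) d := fun d => ih (by omega)
    rw [blockWords, List.mem_flatMap]
    constructor
    · rintro ⟨c, hc, h⟩
      rw [mem_flatMap_insertOdd hNe (by omega) h1] at hc
      exact isBlockWord_of_mem_insertEven (k := 2 * j + 1) hc (by omega) ⟨j + 1, by omega⟩ h
    · intro h
      obtain ⟨c, hc, h⟩ := IsBlockWord.mem_insertEven (k := 2 * j + 1) h (by omega) hNe
        ⟨j + 1, by omega⟩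
      exact ⟨c, (mem_flatMap_insertOdd hNe (by omega) h1).2 hc, h⟩

theorem nodup_blockWords (hNe : Even N) (j : ℕ) (hN : 2 * j < N) : (blockWords N j).Nodup := by
  induction j with
  | zero => simp [blockWords]
  | succ j ih =>
    have h1 : ∀ d, d ∈ blockWords N j ↔ IsBlockWord N (2 * j) d :=
      fun d => mem_blockWords hNe j (by omega)
    have h2 : ∀ d, d ∈ (blockWords N j).flatMap (insertOdd N (2 * j + 1)) ↔
      IsBlockWord N (2 * j + 1) d := fun d => mem_flatMap_insertOdd hNe (by omega) h1
    rw [blockWords]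
    refine nodup_flatMap_of_leftInverse (removeLetter N (2 * j + 2))
      (nodup_flatMap_of_leftInverse (removeLetter N (2 * j + 1)) (ih (by omega)) ?_ ?_) ?_ ?_
    · exact fun c hc => nodup_insertOdd ((h1 c).1 hc) (by omega)
    · exact fun c hc d hd => removeLetter_of_mem_insertOdd ((h1 c).1 hc) (by omega) hd
    · exact fun c hc => nodup_insertEven ((h2 c).1 hc) (by omega)
    · exact fun c hc d hd => removeLetter_of_mem_insertEven ((h2 c).1 hc) (by omega) hd

end Insert

/-! ### What a letter sees to its left and right -/

/-- The first letter of `l` is less than `v`. -/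
def LowHead (v : ℕ) (l : List ℕ) : Prop := ∃ y ∈ l.head?, y < v

/-- The last letter of `l` is greater than `v`. -/
def HighLast (v : ℕ) (l : List ℕ) : Prop := ∃ y ∈ l.getLast?, v < y

instance (v : ℕ) (l : List ℕ) : Decidable (LowHead v l) :=
  inferInstanceAs (Decidable (∃ _ ∈ _, _))

instance (v : ℕ) (l : List ℕ) : Decidable (HighLast v l) :=
  inferInstanceAs (Decidable (∃ _ ∈ _, _))

/-- The number of consecutive letters `x`, `y` of `l` with `y < v < x`. -/
def cross (v : ℕ) : List ℕ → ℕ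
  | [] => 0
  | x :: l => (if v < x ∧ LowHead v l then 1 else 0) + cross v l

theorem lowHead_cons {v x : ℕ} {l : List ℕ} : LowHead v (x :: l) ↔ x < v := by
  simp [LowHead]

theorem lowHead_append_of_lt {v : ℕ} {l X R : List ℕ} (hX : X ≠ []) (h : ∀ x ∈ X, v < x) :
    LowHead v (l ++ (X ++ R)) ↔ LowHead v l := by
  cases l with
  | nil =>
    cases X with
    | nil => exact absurd rfl hX
    | cons x X =>
      have := h x (by simp)
      simp [LowHead]
      omega
  | cons y l => simp [LowHead]

theorem highLast_append_of_lt {v : ℕ} {l X R : List ℕ} (hX : X ≠ []) (h : ∀ x ∈ X, v < x) :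
    HighLast v (l ++ (X ++ R)) ↔ R = [] ∨ HighLast v R := by
  rcases R.eq_nil_or_concat with rfl | ⟨s, z, rfl⟩
  · rcases X.eq_nil_or_concat with rfl | ⟨X, x, rfl⟩
    · exact absurd rfl hX
    · have := h x (by simp)
      simp [HighLast, this]
  · simp [HighLast]

theorem cross_append_of_lt {v : ℕ} {X R : List ℕ} (hX : X ≠ []) (h : ∀ x ∈ X, v < x) :
    cross v (X ++ R) = (if LowHead v R then 1 else 0) + cross v R := by
  induction X with
  | nil => exact absurd rfl hX
  | cons x X ih =>
    have hx := h x (by simp)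
    rw [List.cons_append, cross]
    by_cases h' : X = []
    · simp [h', hx]
    · have hX' : ∀ x ∈ X, v < x := fun y hy => h y (by simp [hy])
      have := lowHead_append_of_lt (l := []) (R := R) h' hX'
      simp only [List.nil_append] at this
      rw [ih h' hX']
      have h0 : ¬ LowHead v (X ++ R) := by rw [this]; simp [LowHead]
      simp [h0]

/-- A nonempty run of letters above `v` counts once if a letter below `v` follows it and not at all
otherwise, whatever its content. -/
theorem cross_append_append_of_lt {v : ℕ} {l X Y R : List ℕ} (hX : X ≠ [])
    (h : ∀ x ∈ X, v < x) (hY : Y ≠ []) (h' : ∀ x ∈ Y, v < x) :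
    cross v (l ++ (X ++ R)) = cross v (l ++ (Y ++ R)) := by
  induction l with
  | nil => simp only [List.nil_append, cross_append_of_lt hX h, cross_append_of_lt hY h']
  | cons x l ih =>
    simp only [List.cons_append, cross, ih, lowHead_append_of_lt hX h,
      lowHead_append_of_lt hY h']

theorem cross_append_right_of_lt {v : ℕ} {l X : List ℕ} (h : ∀ x ∈ X, v < x) :
    cross v (l ++ X) = cross v l := by
  by_cases hX : X = []
  · simp [hX]
  induction l with
  | nil =>
    have := cross_append_of_lt (R := []) hX h
    simpa [LowHead, cross] using this
  | cons x l ih =>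
    have := lowHead_append_of_lt (l := l) (R := []) hX h
    rw [List.append_nil] at this
    simp only [List.cons_append, cross, ih, this]

/-! ### Local weights and their invariance under later insertions -/

section Weight

variable {R : Type*} [CommRing R] (a abar b bbar p q y t : R)

/-- The contribution of the letter `v` with `l` to its left and `r` to its right. -/
def localWeight (v : ℕ) (l r : List ℕ) : R :=
  (if ∀ x ∈ l, x < v then (if Even v then a else abar) else 1) *
    (if ∀ x ∈ r, v < x then (if Even v then bbar else b) else 1) *
    p ^ cross v r * q ^ cross v l * (if LowHead v r then t else 1)

/-- The contribution of the letter `v` of `d`. -/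
def letterWeight (v : ℕ) (d : List ℕ) : R :=
  localWeight a abar b bbar p q t v (before v d) (after v d)

/-- The contribution of the letters `2j + 1` and `2j + 2` of `d`. -/
def pairWeight (j : ℕ) (d : List ℕ) : R :=
  letterWeight a abar b bbar p q t (2 * j + 1) d *
    letterWeight a abar b bbar p q t (2 * j + 2) d *
    (if LowHead (2 * j + 2) (after (2 * j + 2) d) ∧ HighLast (2 * j + 1) (before (2 * j + 1) d)
      then y else 1)

/-- The contribution of the letters `1, …, 2j` of `d`. -/
def blockWeight (j : ℕ) (d : List ℕ) : R :=
  ∏ i ∈ Finset.range j, pairWeight a abar b bbar p q y t i d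

/-- The letter `u` lies on one side of the replaced gap, so only what it sees on the other side
changes. -/
theorem before_after_replace {u N : ℕ} {L X S : List ℕ} (hu : u < N) (hX : ∀ x ∈ X, u < x)
    (h : u ∈ L ++ N :: S) :
    (before u (L ++ (X ++ S)) = before u (L ++ N :: S) ∧
      ∃ l, after u (L ++ (X ++ S)) = l ++ (X ++ S) ∧ after u (L ++ N :: S) = l ++ ([N] ++ S)) ∨
    (after u (L ++ (X ++ S)) = after u (L ++ N :: S) ∧
      ∃ r, before u (L ++ (X ++ S)) = L ++ (X ++ r) ∧ before u (L ++ N :: S) = L ++ ([N] ++ r)) := by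
  by_cases hL : u ∈ L
  · left
    obtain ⟨L₁, L₂, rfl, h1⟩ := List.eq_append_cons_of_mem hL
    simp only [List.append_assoc, List.cons_append, before_append_cons h1, after_append_cons h1]
    exact ⟨trivial, L₂, rfl, rfl⟩
  · right
    have hX' : u ∉ X := fun h => lt_irrefl _ (hX u h)
    have hN : u ∉ [N] := by simp; omega
    rw [← List.singleton_append (l := S)]
    exact ⟨by rw [after_append hL, after_append hX', after_append hL, after_append hN],
      before u S, by rw [before_append hL, before_append hX'],
      by rw [before_append hL, before_append hN]⟩

section Replace

variable {u N : ℕ} {L X S : List ℕ}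

/-- To `u`, the gap and the run `X` look alike: both are nonempty and consist of larger letters. If
they lie to its left, `u` is not a left-to-right maximum in either word. -/
theorem letterWeight_replace (hu : u < N) (hXne : X ≠ []) (hX : ∀ x ∈ X, u < x)
    (h : u ∈ L ++ N :: S) :
    letterWeight a abar b bbar p q t u (L ++ (X ++ S)) =
      letterWeight a abar b bbar p q t u (L ++ N :: S) := by
  have hN : ∀ x ∈ [N], u < x := by simpa using hu
  simp only [letterWeight, localWeight]
  rcases before_after_replace hu hX h with ⟨h1, l, h2, h3⟩ | ⟨h1, r, h2, h3⟩
  · have h4 : (∀ x ∈ l ++ (X ++ S), u < x) ↔ ∀ x ∈ l ++ ([N] ++ S), u < x := by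
      simp only [List.forall_mem_append]
      tauto
    rw [h1, h2, h3, cross_append_append_of_lt hXne hX (List.cons_ne_nil _ _) hN]
    simp only [h4, lowHead_append_of_lt hXne hX, lowHead_append_of_lt (List.cons_ne_nil _ _) hN]
  · have h4 : ¬ ∀ x ∈ L ++ (X ++ r), x < u := by
      obtain ⟨x, hx⟩ := List.exists_mem_of_ne_nil X hXne
      exact fun h => lt_asymm (hX x hx) (h x (by simp [hx]))
    have h5 : ¬ ∀ x ∈ L ++ ([N] ++ r), x < u := fun h => lt_asymm hu (h N (by simp))
    rw [h1, h2, h3, cross_append_append_of_lt hXne hX (List.cons_ne_nil _ _) hN, if_neg h4,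
      if_neg h5]

theorem lowHead_after_replace (hu : u < N) (hXne : X ≠ []) (hX : ∀ x ∈ X, u < x)
    (h : u ∈ L ++ N :: S) :
    LowHead u (after u (L ++ (X ++ S))) ↔ LowHead u (after u (L ++ N :: S)) := by
  have hN : ∀ x ∈ [N], u < x := by simpa using hu
  rcases before_after_replace hu hX h with ⟨h1, l, h2, h3⟩ | ⟨h1, r, h2, h3⟩
  · rw [h2, h3, lowHead_append_of_lt hXne hX, lowHead_append_of_lt (List.cons_ne_nil _ _) hN]
  · rw [h1]

theorem highLast_before_replace (hu : u < N) (hXne : X ≠ []) (hX : ∀ x ∈ X, u < x)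
    (h : u ∈ L ++ N :: S) :
    HighLast u (before u (L ++ (X ++ S))) ↔ HighLast u (before u (L ++ N :: S)) := by
  have hN : ∀ x ∈ [N], u < x := by simpa using hu
  rcases before_after_replace hu hX h with ⟨h1, l, h2, h3⟩ | ⟨h1, r, h2, h3⟩
  · rw [h1]
  · rw [h2, h3, highLast_append_of_lt hXne hX, highLast_append_of_lt (List.cons_ne_nil _ _) hN]

theorem blockWeight_replace {j : ℕ} (hu : 2 * j < N) (hXne : X ≠ []) (hX : ∀ x ∈ X, 2 * j < x)
    (h : ∀ u, 1 ≤ u → u ≤ 2 * j → u ∈ L ++ N :: S) :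
    blockWeight a abar b bbar p q y t j (L ++ (X ++ S)) =
      blockWeight a abar b bbar p q y t j (L ++ N :: S) := by
  refine Finset.prod_congr rfl fun i hi => ?_
  rw [Finset.mem_range] at hi
  have hX1 : ∀ x ∈ X, 2 * i + 1 < x := fun x hx => by have := hX x hx; omega
  have hX2 : ∀ x ∈ X, 2 * i + 2 < x := fun x hx => by have := hX x hx; omega
  have h1 := h (2 * i + 1) (by omega) (by omega)
  have h2 := h (2 * i + 2) (by omega) (by omega)
  simp only [pairWeight, letterWeight_replace a abar b bbar p q t (by omega) hXne hX1 h1,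
    letterWeight_replace a abar b bbar p q t (by omega) hXne hX2 h2,
    lowHead_after_replace (by omega) hXne hX2 h2, highLast_before_replace (by omega) hXne hX1 h1]

end Replace

/-- The contribution of a letter inserted at a gap with `i` gaps to its left and `j` gaps to its
right, not counting the gap itself. -/
def gapWeight (x z : R) (i j : ℕ) : R :=
  (if i = 0 then x else 1) * (if j = 0 then z else 1) * p ^ j * q ^ i

/-! ### The weight of a newly inserted letter -/

section Insert

variable {N k : ℕ} {L S : List ℕ}

theorem cross_append_singleton {s : List ℕ} (hs : (s ++ [N]).IsChain StepRel)
    (hN : k + 1 < N) (hm : ∀ x ∈ s, x = N ∨ x ≤ k) :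
    cross (k + 1) (s ++ [N]) = s.count N := by
  induction s with
  | nil => simp [cross, LowHead]
  | cons x s ih =>
    rw [List.cons_append, List.isChain_cons] at hs
    have hm' : ∀ x ∈ s, x = N ∨ x ≤ k := fun y hy => hm y (by simp [hy])
    rw [List.cons_append, cross, ih hs.2 hm', List.count_cons, add_comm]
    congr 1
    rcases hm x (by simp) with rfl | hx
    · have : LowHead (k + 1) (s ++ [x]) := by
        cases s with
        | nil => exact absurd rfl (hs.1 x (by simp)).ne
        | cons z s =>
          have h1 := (hs.1 z (by simp)).ne
          have h2 := hm' z (by simp)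
          rw [List.cons_append, lowHead_cons]
          omega
      simp [hN, this]
    · have h1 : ¬ k + 1 < x := by omega
      have h2 : x ≠ N := by omega
      simp [h1, h2]

/-- All letters present are below `k + 1`, so only gaps exceed it, and every gap except the last is
followed by a smaller letter. Hence each statistic is a count of gaps. -/
theorem IsBlockWord.gap_facts (hd : IsBlockWord N k (L ++ N :: S)) (hN : k + 1 < N) :
    cross (k + 1) L = L.count N ∧ cross (k + 1) (N :: S) = S.count N ∧
      cross (k + 1) S = S.count N - 1 ∧
      ((∀ x ∈ L, x < k + 1) ↔ L.count N = 0) ∧ ((∀ x ∈ S, k + 1 < x) ↔ S.count N = 0) ∧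
      (S = [] ↔ S.count N = 0) ∧ (LowHead (k + 1) S ↔ S ≠ []) := by
  have hm : ∀ x ∈ L ++ N :: S, x = N ∨ x ≤ k := fun x hx => by
    rcases hd.mem x hx with h | h
    · exact Or.inl h
    · exact Or.inr h.2
  obtain ⟨h1, h2, h3, h4, h5⟩ := hd.cut
  have hch := hd.chain
  have hLN : (L ++ [N]).IsChain StepRel := by
    have : L ++ N :: S = (L ++ [N]) ++ S := by simp
    rw [this, List.isChain_append] at hch
    exact hch.1
  have hS : S = [] ↔ S.count N = 0 := by
    rcases h5 with rfl | ⟨s, rfl⟩ <;> simp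
  have hlow : LowHead (k + 1) S ↔ S ≠ [] := by
    cases S with
    | nil => simp [LowHead]
    | cons x S =>
      have := h4 x (by simp)
      simp only [lowHead_cons, ne_eq, List.cons_ne_nil, not_false_eq_true, iff_true]
      omega
  have hcS : cross (k + 1) S = S.count N - 1 := by
    rcases h5 with rfl | ⟨s, rfl⟩
    · simp [cross]
    · rw [cross_append_singleton h2 hN fun x hx => hm x (by simp [hx])]
      simp
  refine ⟨?_, ?_, hcS, ?_, ?_, hS, hlow⟩
  · rw [← cross_append_right_of_lt (X := [N]) (by simpa using hN)]
    exact cross_append_singleton hLN hN fun x hx => hm x (by simp [hx])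
  · rw [cross, hcS]
    by_cases h : S = []
    · simp [h, LowHead]
    · have := hlow.2 h
      rw [if_pos ⟨hN, this⟩]
      have := mt hS.2 h
      omega
  · rw [List.count_eq_zero]
    constructor
    · intro h hmem
      have := h N hmem
      omega
    · intro h x hx
      have := hm x (by simp [hx])
      have : x ≠ N := fun e => h (e ▸ hx)
      omega
  · rw [← hS]
    constructor
    · intro h
      cases S with
      | nil => rfl
      | cons x S =>
        have h1 := h4 x (by simp)
        have h2 := h x (by simp)
        omega
    · rintro rfl
      simp

theorem letterWeight_appendLetter (hd : IsBlockWord N k (L ++ N :: S)) (hN : k + 1 < N) :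
    letterWeight a abar b bbar p q t (k + 1) (appendLetter N (k + 1) (L, S)) =
      gapWeight p q (if Even (k + 1) then a else abar) (if Even (k + 1) then bbar else b)
        (L.count N) (S.count N) := by
  obtain ⟨h1, h2, h3, h4, h5, h6, h7⟩ := hd.gap_facts hN
  have hL := (hd.cut_facts hN).1
  have h8 : (∀ x ∈ N :: S, k + 1 < x) ↔ S.count N = 0 := by
    rw [List.forall_mem_cons, h5]
    exact and_iff_right hN
  have h9 : ¬ LowHead (k + 1) (N :: S) := by rw [lowHead_cons]; omega
  simp only [letterWeight, appendLetter, before_append_cons hL, after_append_cons hL, localWeight,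
    h1, h2, h4, h8, if_neg h9, gapWeight, mul_one]

theorem newLetter_eq : newLetter N (k + 1) (L, S) = (L ++ [N]) ++ (k + 1) :: N :: S := by
  simp [newLetter]

/-- The gap directly before the letter prevents a left-to-right maximum, hence the 1. It gives no
factor `q`, as the letter itself follows it. -/
theorem letterWeight_newLetter (hd : IsBlockWord N k (L ++ N :: S)) (hN : k + 1 < N)
    (ho : Odd (k + 1)) :
    letterWeight a abar b bbar p q t (k + 1) (newLetter N (k + 1) (L, S)) =
      gapWeight p q 1 b (L.count N) (S.count N) := by
  obtain ⟨h1, h2, h3, h4, h5, h6, h7⟩ := hd.gap_facts hN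
  have hL : k + 1 ∉ L ++ [N] := by
    have := (hd.cut_facts hN).1
    simp [this]
    omega
  have h8 : (∀ x ∈ N :: S, k + 1 < x) ↔ S.count N = 0 := by
    rw [List.forall_mem_cons, h5]
    exact and_iff_right hN
  have h9 : ¬ LowHead (k + 1) (N :: S) := by rw [lowHead_cons]; omega
  have h10 : ¬ ∀ x ∈ L ++ [N], x < k + 1 := fun h => lt_asymm hN (h N (by simp))
  have h11 : ¬ Even (k + 1) := Nat.not_even_iff_odd.2 ho
  simp only [newLetter_eq, letterWeight, before_append_cons hL, after_append_cons hL, localWeight,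
    cross_append_right_of_lt (X := [N]) (l := L) (v := k + 1) (by simpa using hN),
    h1, h2, if_neg h10, h8, if_neg h9, if_neg h11, gapWeight, mul_one, ite_self]

/-- A smaller letter follows, which gives `t` and prevents a right-to-left minimum. The last gap on
the right is not followed by a smaller letter, hence `S.count N - 1`. -/
theorem letterWeight_joinLetter (hd : IsBlockWord N k (L ++ N :: S)) (hN : k + 1 < N)
    (he : Even (k + 1)) (hS : S ≠ []) :
    letterWeight a abar b bbar p q t (k + 1) (joinLetter (k + 1) (L, S)) =
      gapWeight p q a 1 (L.count N) (S.count N - 1) * t := by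
  obtain ⟨h1, h2, h3, h4, h5, h6, h7⟩ := hd.gap_facts hN
  have hL := (hd.cut_facts hN).1
  have h8 : ¬ ∀ x ∈ S, k + 1 < x := by rwa [h5, ← h6]
  simp only [letterWeight, joinLetter, before_append_cons hL, after_append_cons hL, localWeight,
    h1, h3, h4, if_neg h8, if_pos (h7.2 hS), if_pos he, gapWeight, mul_one, ite_self]

end Insert

theorem sum_Icc_one {M : Type*} [AddCommMonoid M] (f : ℕ → M) (h : ℕ) :
    ∑ i ∈ Finset.Icc 1 h, f i = ∑ i ∈ Finset.range h, f (i + 1) := by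
  induction h with
  | zero => simp
  | succ h ih => rw [Finset.sum_Icc_succ_top (by omega), ih, Finset.sum_range_succ]

theorem sum_range_gapWeight (x z : R) (h : ℕ) :
    ∑ i ∈ Finset.range (h + 1), gapWeight p q x z i (h - i) = pqIntTwo x (h + 1) z p q := by
  -- With a single gap both boundary factors fall on the same term; this is the special case `[x, 1,
  -- z] = x z`.
  rcases h with _ | h
  · simp [gapWeight, pqIntTwo]
  · rw [Finset.sum_range_succ, Finset.sum_range_succ', pqIntTwo, if_neg (by omega),
      add_comm _ (gapWeight p q x z 0 _), sum_Icc_one]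
    congr 1
    · congr 1
      · simp [gapWeight]
      · refine Finset.sum_congr rfl fun i hi => ?_
        rw [Finset.mem_range] at hi
        have h1 : h + 1 - (i + 1) ≠ 0 := by omega
        simp only [gapWeight, if_neg h1, if_neg (Nat.succ_ne_zero i), one_mul]
        rfl
    · simp [gapWeight]

theorem sum_range_gapWeight_one (x : R) (h : ℕ) :
    ∑ i ∈ Finset.range (h + 1), gapWeight p q x 1 i (h - i) = pqInt x (h + 1) p q := by
  rw [Finset.sum_range_succ', pqInt, add_comm, Nat.add_sub_cancel, sum_Icc_one]
  simp [gapWeight]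

/-- Reading the gaps from right to left exchanges `p` and `q`. -/
theorem sum_range_one_gapWeight (z : R) (h : ℕ) :
    ∑ i ∈ Finset.range (h + 1), gapWeight p q 1 z i (h - i) = pqInt z (h + 1) q p := by
  rw [← sum_range_gapWeight_one, ← Finset.sum_range_reflect]
  refine Finset.sum_congr rfl fun i hi => ?_
  rw [Finset.mem_range] at hi
  have h1 : h + 1 - 1 - i = h - i := by omega
  have h2 : h - (h - i) = i := by omega
  simp only [h1, h2, gapWeight]
  ring

end Weight

/-! ### The transfer operator on the number of gaps -/

section Transfer

variable {R : Type*} [CommRing R] (a abar b bbar p q y t : R) {N : ℕ}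

theorem sum_map_filter_eq {α : Type*} (P : α → Prop) [DecidablePred P] (f : α → R)
    (l : List α) :
    ((l.filter P).map f).sum = (l.map fun x => if P x then f x else 0).sum := by
  induction l with
  | nil => simp
  | cons x l ih => by_cases h : P x <;> simp [h, ih]

theorem sum_map_congr {α : Type*} {f g : α → R} {l : List α} (h : ∀ x ∈ l, f x = g x) :
    (l.map f).sum = (l.map g).sum := by
  rw [List.map_congr_left h]

theorem sum_map_flatMap {α β : Type*} (f : β → R) (g : α → List β) (l : List α) :
    ((l.flatMap g).map f).sum = (l.map fun x => ((g x).map f).sum).sum := by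
  induction l with
  | nil => simp
  | cons x l ih => simp [ih]

theorem sum_map_splits {c : List ℕ} {F : List ℕ × List ℕ → R} (G : ℕ → ℕ → R) {K : R}
    (h : ∀ s ∈ splits N c, F s = G (s.1.count N) (s.2.count N) * K) :
    ((splits N c).map F).sum =
      (∑ i ∈ Finset.range (c.count N), G i (c.count N - 1 - i)) * K := by
  rw [sum_map_congr h, List.sum_map_mul_right, sum_splits]

/-- The sum over the insertions of an odd letter. -/
theorem sum_insertOdd {j : ℕ} {c : List ℕ} (hc : IsBlockWord N (2 * j) c) (hN : 2 * j + 1 < N)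
    (ψ : ℕ → Prop → R) :
    ((insertOdd N (2 * j + 1) c).map fun d => blockWeight a abar b bbar p q y t j d *
        letterWeight a abar b bbar p q t (2 * j + 1) d *
        ψ (d.count N - 1) (HighLast (2 * j + 1) (before (2 * j + 1) d))).sum =
      blockWeight a abar b bbar p q y t j c *
        (pqIntTwo abar (c.count N) b p q * ψ (c.count N - 1) False +
          pqInt b (c.count N) q p * ψ (c.count N) True) := by
  obtain ⟨h, hh⟩ : ∃ h, c.count N = h + 1 := by
    obtain ⟨s, rfl⟩ := hc.last
    exact ⟨s.count N, by simp⟩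
  have hodd : Odd (2 * j + 1) := ⟨j, rfl⟩
  have hev : ¬ Even (2 * j + 1) := Nat.not_even_iff_odd.2 hodd
  rw [insertOdd, List.map_append, List.sum_append, List.map_map, List.map_map, mul_add]
  congr 1
  · have key : ∀ s ∈ splits N c, ((fun d => blockWeight a abar b bbar p q y t j d *
        letterWeight a abar b bbar p q t (2 * j + 1) d *
        ψ (d.count N - 1) (HighLast (2 * j + 1) (before (2 * j + 1) d))) ∘
          appendLetter N (2 * j + 1)) s =
        gapWeight p q abar b (s.1.count N) (s.2.count N) * (blockWeight a abar b bbar p q y t j c *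
          ψ (c.count N - 1) False) := by
      rintro ⟨L, S⟩ hs
      obtain rfl := mem_splits.1 hs
      have h1 := letterWeight_appendLetter a abar b bbar p q t hc hN
      rw [if_neg hev, if_neg hev] at h1
      have h2 : blockWeight a abar b bbar p q y t j (L ++ ([2 * j + 1, N] ++ S)) = _ :=
        blockWeight_replace a abar b bbar p q y t (N := N) (by omega)
          (by simp) (by simp; omega) fun u hu hu' => List.count_pos_iff.1 (by
            rw [hc.count u hu hu']; omega)
      have h3 : (appendLetter N (2 * j + 1) (L, S)).count N = (L ++ N :: S).count N := by
        simp only [appendLetter, List.count_append]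
        rw [List.count_cons_of_ne (by omega)]
      have h4 : ¬ HighLast (2 * j + 1) (before (2 * j + 1) (appendLetter N (2 * j + 1) (L, S))) := by
        have h5 := hc.cut.2.2.1
        rw [appendLetter, before_append_cons (hc.cut_facts hN).1]
        rintro ⟨x, hx, hx'⟩
        have := h5 x hx
        omega
      simp only [Function.comp_apply, h1, h3, eq_false h4]
      rw [show appendLetter N (2 * j + 1) (L, S) = L ++ ([2 * j + 1, N] ++ S) from rfl, h2]
      ring
    rw [sum_map_splits (gapWeight p q abar b) key, hh, Nat.add_sub_cancel,
      sum_range_gapWeight]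
    ring
  · have key : ∀ s ∈ splits N c, ((fun d => blockWeight a abar b bbar p q y t j d *
        letterWeight a abar b bbar p q t (2 * j + 1) d *
        ψ (d.count N - 1) (HighLast (2 * j + 1) (before (2 * j + 1) d))) ∘
          newLetter N (2 * j + 1)) s =
        gapWeight p q 1 b (s.1.count N) (s.2.count N) * (blockWeight a abar b bbar p q y t j c *
          ψ (c.count N) True) := by
      rintro ⟨L, S⟩ hs
      obtain rfl := mem_splits.1 hs
      have h1 := letterWeight_newLetter a abar b bbar p q t hc hN hodd
      have h2 : blockWeight a abar b bbar p q y t j (L ++ ([N, 2 * j + 1, N] ++ S)) = _ :=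
        blockWeight_replace a abar b bbar p q y t (N := N) (by omega)
          (by simp) (by simp; omega) fun u hu hu' => List.count_pos_iff.1 (by
            rw [hc.count u hu hu']; omega)
      have h3 : (newLetter N (2 * j + 1) (L, S)).count N - 1 = (L ++ N :: S).count N := by
        simp only [newLetter, List.count_append, List.count_cons_self]
        rw [List.count_cons_of_ne (by omega), List.count_cons_self]
        omega
      have h4 : HighLast (2 * j + 1) (before (2 * j + 1) (newLetter N (2 * j + 1) (L, S))) := by
        have hL : 2 * j + 1 ∉ L ++ [N] := by
          have := (hc.cut_facts hN).1
          simp [this]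
          omega
        rw [newLetter_eq, before_append_cons hL]
        exact ⟨N, by simp, hN⟩
      simp only [Function.comp_apply, h1, h3, eq_true h4]
      rw [show newLetter N (2 * j + 1) (L, S) = L ++ ([N, 2 * j + 1, N] ++ S) from rfl, h2]
      ring
    rw [sum_map_splits (gapWeight p q 1 b) key, hh, Nat.add_sub_cancel,
      sum_range_one_gapWeight]
    ring

/-- The sum over the insertions of an even letter. -/
theorem sum_insertEven {j : ℕ} {c : List ℕ} (hc : IsBlockWord N (2 * j + 1) c)
    (hN : 2 * j + 2 < N) (φ : ℕ → R) :
    ((insertEven N (2 * j + 2) c).map fun d => blockWeight a abar b bbar p q y t (j + 1) d *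
        φ (d.count N - 1)).sum =
      blockWeight a abar b bbar p q y t j c *
        letterWeight a abar b bbar p q t (2 * j + 1) c *
        (pqIntTwo a (c.count N) bbar p q * φ (c.count N - 1) +
          if c.count N = 1 then 0 else
            pqInt a (c.count N - 1) p q * t *
              (if HighLast (2 * j + 1) (before (2 * j + 1) c) then y else 1) *
                φ (c.count N - 2)) := by
  obtain ⟨h, hh⟩ : ∃ h, c.count N = h + 1 := by
    obtain ⟨s, rfl⟩ := hc.last
    exact ⟨s.count N, by simp⟩
  have hev : Even (2 * j + 1 + 1) := ⟨j + 1, by omega⟩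
  have hmem : ∀ u, 1 ≤ u → u ≤ 2 * j + 1 → u ∈ c := fun u hu hu' => List.count_pos_iff.1 (by
    rw [hc.count u hu hu']; omega)
  rw [insertEven, List.map_append, List.sum_append, List.map_map, List.map_map, mul_add]
  congr 1
  · have key : ∀ s ∈ splits N c, ((fun d => blockWeight a abar b bbar p q y t (j + 1) d *
        φ (d.count N - 1)) ∘ appendLetter N (2 * j + 2)) s =
        gapWeight p q a bbar (s.1.count N) (s.2.count N) * (blockWeight a abar b bbar p q y t j c *
          letterWeight a abar b bbar p q t (2 * j + 1) c *
          φ (c.count N - 1)) := by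
      rintro ⟨L, S⟩ hs
      obtain rfl := mem_splits.1 hs
      have h1 := letterWeight_appendLetter a abar b bbar p q t hc hN
      rw [if_pos hev, if_pos hev] at h1
      have h2 : blockWeight a abar b bbar p q y t j (L ++ ([2 * j + 2, N] ++ S)) = _ :=
        blockWeight_replace a abar b bbar p q y t (N := N) (by omega)
          (by simp) (by simp; omega) fun u hu hu' => hmem u hu (by omega)
      have h5 : letterWeight a abar b bbar p q t (2 * j + 1) (L ++ ([2 * j + 2, N] ++ S)) = _ :=
        letterWeight_replace a abar b bbar p q t (N := N) (by omega)
          (by simp) (by simp; omega) (hmem _ (by omega) le_rfl)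
      have h3 : (appendLetter N (2 * j + 2) (L, S)).count N = (L ++ N :: S).count N := by
        simp only [appendLetter, List.count_append]
        rw [List.count_cons_of_ne (by omega)]
      have h4 : ¬ LowHead (2 * j + 2) (after (2 * j + 2) (appendLetter N (2 * j + 2) (L, S))) := by
        rw [appendLetter, after_append_cons (hc.cut_facts hN).1, lowHead_cons]
        omega
      have h6 : appendLetter N (2 * j + 2) (L, S) = L ++ ([2 * j + 2, N] ++ S) := rfl
      rw [Function.comp_apply, blockWeight, Finset.prod_range_succ, ← blockWeight, pairWeight,
        if_neg (fun h => h4 h.1), h1, h3, h6, h2, h5]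
      ring
    rw [sum_map_splits (gapWeight p q a bbar) key, hh, Nat.add_sub_cancel,
      sum_range_gapWeight]
    ring
  · rw [sum_map_filter_eq]
    have key : ∀ s ∈ splits N c, (if s.2 ≠ [] then
        ((fun d => blockWeight a abar b bbar p q y t (j + 1) d *
        φ (d.count N - 1)) ∘ joinLetter (2 * j + 2)) s else 0) =
        (if s.2.count N = 0 then 0 else gapWeight p q a 1 (s.1.count N) (s.2.count N - 1)) *
          (blockWeight a abar b bbar p q y t j c *
          letterWeight a abar b bbar p q t (2 * j + 1) c * t *
          (if HighLast (2 * j + 1) (before (2 * j + 1) c) then y else 1) *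
          φ (c.count N - 2)) := by
      rintro ⟨L, S⟩ hs
      obtain rfl := mem_splits.1 hs
      obtain ⟨-, -, -, -, -, hS, hlow⟩ := hc.gap_facts hN
      by_cases hS' : S = []
      · simp [hS']
      rw [if_pos hS', if_neg (mt hS.2 hS' : ¬ S.count N = 0)]
      have h1 := letterWeight_joinLetter a abar b bbar p q t hc hN hev hS'
      have h2 : blockWeight a abar b bbar p q y t j (L ++ ([2 * j + 2] ++ S)) = _ :=
        blockWeight_replace a abar b bbar p q y t (N := N) (by omega)
          (by simp) (by simp) fun u hu hu' => hmem u hu (by omega)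
      have h5 : letterWeight a abar b bbar p q t (2 * j + 1) (L ++ ([2 * j + 2] ++ S)) = _ :=
        letterWeight_replace a abar b bbar p q t (N := N) (by omega)
          (by simp) (by simp) (hmem _ (by omega) le_rfl)
      have h7 : HighLast (2 * j + 1) (before (2 * j + 1) (L ++ ([2 * j + 2] ++ S))) ↔ _ :=
        highLast_before_replace (N := N) (by omega) (by simp) (by simp)
          (hmem _ (by omega) le_rfl)
      have h3 : (joinLetter (2 * j + 2) (L, S)).count N - 1 = (L ++ N :: S).count N - 2 := by
        simp only [joinLetter, List.count_append, List.count_cons_self]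
        rw [List.count_cons_of_ne (by omega)]
        omega
      have h4 : LowHead (2 * j + 2) (after (2 * j + 2) (joinLetter (2 * j + 2) (L, S))) := by
        rw [joinLetter, after_append_cons (hc.cut_facts hN).1]
        exact hlow.2 hS'
      have h6 : joinLetter (2 * j + 2) (L, S) = L ++ ([2 * j + 2] ++ S) := rfl
      rw [Function.comp_apply, blockWeight, Finset.prod_range_succ, ← blockWeight, pairWeight]
      simp only [eq_true h4, true_and]
      rw [h1, h3, h6, h2, h5]
      simp only [h7]
      ring
    -- The last gap, the one with `k = 0`, cannot be closed; it contributes 0, so one term fewer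
    -- remains.
    rw [sum_map_splits (fun i k => if k = 0 then 0 else gapWeight p q a 1 i (k - 1)) key, hh]
    rcases h with _ | h
    · simp
    · have hsum : ∑ i ∈ Finset.range (h + 1), (if h + 1 + 1 - 1 - i = 0 then 0 else
          gapWeight p q a 1 i (h + 1 + 1 - 1 - i - 1)) = pqInt a (h + 1) p q := by
        rw [← sum_range_gapWeight_one]
        refine Finset.sum_congr rfl fun i hi => ?_
        rw [Finset.mem_range] at hi
        rw [if_neg (by omega), show h + 1 + 1 - 1 - i - 1 = h - i by omega]
      rw [Finset.sum_range_succ, hsum, if_neg (show ¬ h + 1 + 1 = 1 by omega),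
        if_pos (show h + 1 + 1 - 1 - (h + 1) = 0 by omega), add_zero,
        Nat.add_sub_cancel]
      ring

/-- The transfer operator of the insertion of two letters. -/
def transfer : (ℕ → R) → ℕ → R :=
  tridiag (fun h => pqInt b (h + 1) q p * pqIntTwo a (h + 2) bbar p q)
    (fun h => coeffB a abar b bbar p q y t (h + 1))
    (fun h => pqIntTwo abar (h + 2) b p q * (t * pqInt a (h + 1) p q))

theorem sum_flatMap_insert {j : ℕ} {c : List ℕ} (hc : IsBlockWord N (2 * j) c)
    (hNe : Even N) (hN : 2 * j + 2 < N) (φ : ℕ → R) :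
    (((insertOdd N (2 * j + 1) c).flatMap (insertEven N (2 * j + 2))).map fun d =>
        blockWeight a abar b bbar p q y t (j + 1) d * φ (d.count N - 1)).sum =
      blockWeight a abar b bbar p q y t j c *
        transfer a abar b bbar p q y t φ (c.count N - 1) := by
  classical
  -- `ψ h P` is the outcome of the even insertions at height `h`; `P` records whether `2j + 1` is a
  -- descent bottom, in which case closing a gap completes a domino.
  set ψ : ℕ → Prop → R := fun h P => pqIntTwo a (h + 1) bbar p q * φ h + if h = 0 then 0 else
      pqInt a h p q * t * (if P then y else 1) * φ (h - 1) with hψ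
  have key : ∀ d ∈ insertOdd N (2 * j + 1) c,
      ((insertEven N (2 * j + 2) d).map fun d => blockWeight a abar b bbar p q y t (j + 1) d *
        φ (d.count N - 1)).sum = blockWeight a abar b bbar p q y t j d *
        letterWeight a abar b bbar p q t (2 * j + 1) d *
        ψ (d.count N - 1) (HighLast (2 * j + 1) (before (2 * j + 1) d)) := by
    intro d hd
    have hd' := isBlockWord_of_mem_insertOdd hc (by omega) hNe ⟨j, rfl⟩ hd
    obtain ⟨h, hh⟩ : ∃ h, d.count N = h + 1 := by
      obtain ⟨s, rfl⟩ := hd'.last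
      exact ⟨s.count N, by simp⟩
    rw [sum_insertEven a abar b bbar p q y t hd' hN φ, hh, hψ]
    congr 2
    rcases h with _ | h <;> simp
  rw [sum_map_flatMap, sum_map_congr key,
    sum_insertOdd a abar b bbar p q y t hc (by omega)]
  obtain ⟨h, hh⟩ : ∃ h, c.count N = h + 1 := by
    obtain ⟨s, rfl⟩ := hc.last
    exact ⟨s.count N, by simp⟩
  rw [hh, hψ]
  congr 1
  rcases h with _ | h
  · simp [transfer, tridiag, coeffB]
    ring
  · simp [transfer, tridiag, coeffB]
    ring

/-- The operator acts on test functions `φ` of the height: the last pair of insertions replaces `φ`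
by its transfer, so words need not be sorted by height. -/
theorem sum_blockWords (hNe : Even N) (j : ℕ) (hN : 2 * j < N) (φ : ℕ → R) :
    ((blockWords N j).map fun d => blockWeight a abar b bbar p q y t j d *
      φ (d.count N - 1)).sum = (transfer a abar b bbar p q y t)^[j] φ 0 := by
  induction j generalizing φ with
  | zero => simp [blockWords, blockWeight]
  | succ j ih =>
    rw [Function.iterate_succ_apply, ← ih (by omega), blockWords, List.flatMap_assoc,
      sum_map_flatMap]
    refine sum_map_congr fun c hc => ?_
    exact sum_flatMap_insert a abar b bbar p q y t ((mem_blockWords hNe j (by omega)).1 hc)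
      hNe (by omega) φ

end Transfer

/-! ### Permutations as block words with a single gap -/

section Words

variable {m : ℕ} (σ : Equiv.Perm (Fin m))

/-- The letter at position `i`, and a large letter past the end. -/
def extLetter (i : ℕ) : ℕ := if h : i < m then letter σ ⟨i, h⟩ else m + 2

/-- The word of `σ`, followed by the letter `m + 2`. -/
def word : List ℕ := (List.range (m + 1)).map (extLetter σ)

theorem extLetter_coe (i : Fin m) : extLetter σ i = letter σ i := by simp [extLetter]

theorem extLetter_self : extLetter σ m = m + 2 := by simp [extLetter]

theorem letter_pos (i : Fin m) : 1 ≤ letter σ i := by simp [letter]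

theorem letter_le (i : Fin m) : letter σ i ≤ m := by
  have := (σ i).2
  simp only [letter]
  omega

theorem letter_injective : Function.Injective (letter σ) := by
  intro i j h
  apply σ.injective
  ext
  simpa [letter] using h

theorem exists_letter_eq {v : ℕ} (h : 1 ≤ v) (h' : v ≤ m) : ∃ i, letter σ i = v :=
  ⟨σ.symm ⟨v - 1, by omega⟩, by simp [letter]; omega⟩

theorem extLetter_of_lt {i : ℕ} (h : i < m) : extLetter σ i = letter σ ⟨i, h⟩ := by
  simp [extLetter, h]

theorem word_eq_append : word σ = (List.range m).map (extLetter σ) ++ [m + 2] := by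
  simp [word, List.range_succ, extLetter_self]

theorem word_eq_cut (i : Fin m) : word σ = (List.range i).map (extLetter σ) ++
    letter σ i :: (List.range' (i + 1) (m - i)).map (extLetter σ) := by
  have h : List.range (m + 1) = List.range i ++ (i : ℕ) :: List.range' (i + 1) (m - i) := by
    have h1 : m + 1 = i + (m - i + 1) := by omega
    rw [List.range_eq_range', List.range_eq_range', h1, ← List.range'_append, List.range'_succ]
    simp
  rw [word, h, List.map_append, List.map_cons, extLetter_coe]

theorem letter_notMem (i : Fin m) : letter σ i ∉ (List.range i).map (extLetter σ) := by
  intro h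
  obtain ⟨j, hj, h⟩ := List.mem_map.1 h
  rw [List.mem_range] at hj
  rw [extLetter_of_lt σ (hj.trans i.2)] at h
  have := congrArg Fin.val (letter_injective σ h)
  simp only at this
  omega

theorem before_word (i : Fin m) :
    before (letter σ i) (word σ) = (List.range i).map (extLetter σ) := by
  rw [word_eq_cut σ i, before_append_cons (letter_notMem σ i)]

theorem after_word (i : Fin m) :
    after (letter σ i) (word σ) = (List.range' (i + 1) (m - i)).map (extLetter σ) := by
  rw [word_eq_cut σ i, after_append_cons (letter_notMem σ i)]

theorem forall_before_word (i : Fin m) :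
    (∀ x ∈ before (letter σ i) (word σ), x < letter σ i) ↔ IsLRMax σ i := by
  rw [before_word]
  simp only [List.mem_map, List.mem_range, forall_exists_index, and_imp, forall_apply_eq_imp_iff₂,
    IsLRMax]
  constructor
  · intro h j hj
    rw [← extLetter_coe σ j]
    exact h j hj
  · intro h j hj
    rw [extLetter_of_lt σ (hj.trans i.2)]
    exact h _ hj

theorem forall_after_word (i : Fin m) :
    (∀ x ∈ after (letter σ i) (word σ), letter σ i < x) ↔ IsRLMin σ i := by
  rw [after_word]
  constructor
  · intro h j hj
    rw [← extLetter_coe σ j]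
    exact h _ (List.mem_map.2 ⟨j, by rw [List.mem_range'_1]; omega, rfl⟩)
  · intro h x hx
    obtain ⟨j, hj, rfl⟩ := List.mem_map.1 hx
    rw [List.mem_range'_1] at hj
    by_cases hjm : j < m
    · rw [extLetter_of_lt σ hjm]
      exact h ⟨j, hjm⟩ hj.1
    · have := letter_le σ i
      simp only [extLetter, hjm, dite_false]
      omega

theorem lowHead_after_word (i : Fin m) :
    LowHead (letter σ i) (after (letter σ i) (word σ)) ↔ ∃ j, IsDescent σ i j := by
  have h : m - i = (m - i - 1) + 1 := by omega
  rw [after_word, h, List.range'_succ, List.map_cons, lowHead_cons]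
  constructor
  · intro h
    by_cases hjm : (i : ℕ) + 1 < m
    · rw [extLetter_of_lt σ hjm] at h
      exact ⟨_, rfl, h⟩
    · have := letter_le σ i
      simp only [extLetter, hjm, dite_false] at h
      omega
  · rintro ⟨j, hj, h⟩
    rwa [hj, extLetter_coe]

theorem highLast_before_word (i : Fin m) :
    HighLast (letter σ i) (before (letter σ i) (word σ)) ↔ ∃ j, IsDescent σ j i := by
  rw [before_word]
  obtain ⟨i, hi⟩ := i
  rcases i with _ | i
  · simp [HighLast, IsDescent]
  · simp only [List.range_succ, List.map_append, List.map_cons, List.map_nil, HighLast,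
      List.getLast?_append, List.getLast?_singleton, Option.some_or, Option.mem_def,
      Option.some.injEq, exists_eq_left']
    constructor
    · intro h
      rw [extLetter_of_lt σ (by omega : i < m)] at h
      exact ⟨⟨i, by omega⟩, rfl, h⟩
    · rintro ⟨j, hj, h⟩
      have : (j : ℕ) = i := by simp only at hj; omega
      rwa [← extLetter_coe σ j, this] at h

theorem lowHead_after_word_iff {v : ℕ} (h : 1 ≤ v) (h' : v ≤ m) :
    LowHead v (after v (word σ)) ↔ IsDescentTop σ v := by
  obtain ⟨i, rfl⟩ := exists_letter_eq σ h h'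
  rw [lowHead_after_word]
  constructor
  · rintro ⟨j, h⟩
    exact ⟨i, j, h, rfl⟩
  · rintro ⟨i', j, h, e⟩
    exact ⟨j, letter_injective σ e ▸ h⟩

theorem highLast_before_word_iff {v : ℕ} (h : 1 ≤ v) (h' : v ≤ m) :
    HighLast v (before v (word σ)) ↔ IsDescentBottom σ v := by
  obtain ⟨i, rfl⟩ := exists_letter_eq σ h h'
  rw [highLast_before_word]
  constructor
  · rintro ⟨j, h⟩
    exact ⟨j, i, h, rfl⟩
  · rintro ⟨j, i', h, e⟩
    exact ⟨j, letter_injective σ e ▸ h⟩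

theorem cross_map_range' (f : ℕ → ℕ) (v s len : ℕ) :
    cross v ((List.range' s (len + 1)).map f) =
      ∑ j ∈ Finset.range len, if v < f (s + j) ∧ f (s + j + 1) < v then 1 else 0 := by
  induction len generalizing s with
  | zero => simp [cross, LowHead]
  | succ len ih =>
    rw [List.range'_succ, List.map_cons, cross, ih, Finset.sum_range_succ', add_comm]
    congr 1
    · refine Finset.sum_congr rfl fun j _ => ?_
      rw [show s + (j + 1) = s + 1 + j by omega]
    · simp only [List.range'_succ, List.map_cons, lowHead_cons, add_zero]

theorem cross_before_word (i : Fin m) : cross (letter σ i) (before (letter σ i) (word σ)) =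
    ∑ d : Fin m, if d < i ∧ ∃ k : Fin m, (k : ℕ) + 1 = (d : ℕ) ∧
      letter σ i < letter σ k ∧ letter σ d < letter σ i then 1 else 0 := by
  have h1 : ∀ d : Fin m, (d < i ∧ ∃ k : Fin m, (k : ℕ) + 1 = (d : ℕ) ∧
      letter σ i < letter σ k ∧ letter σ d < letter σ i) ↔ ((d : ℕ) < i ∧ 1 ≤ (d : ℕ) ∧
      letter σ i < extLetter σ ((d : ℕ) - 1) ∧ extLetter σ (d : ℕ) < letter σ i) := by
    intro d
    refine and_congr Iff.rfl ?_
    constructor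
    · rintro ⟨k, hk, h⟩
      rw [← hk, Nat.add_sub_cancel, extLetter_coe, hk, extLetter_coe]
      exact ⟨by omega, h⟩
    · rintro ⟨h, h'⟩
      have hdm : (d : ℕ) - 1 < m := by have := d.2; omega
      rw [extLetter_coe, extLetter_of_lt σ hdm] at h'
      exact ⟨⟨(d : ℕ) - 1, hdm⟩, Nat.sub_add_cancel h, h'⟩
  simp only [h1]
  rw [Fin.sum_univ_eq_sum_range (fun d => if d < (i : ℕ) ∧ 1 ≤ d ∧
      letter σ i < extLetter σ (d - 1) ∧ extLetter σ d < letter σ i then 1 else 0) m, before_word]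
  -- The first position has no predecessor and drops out.
  rw [Finset.range_eq_Ico, ← Finset.sum_subset (s₁ := Finset.Ico 1 (i : ℕ))]
  · rw [Finset.sum_Ico_eq_sum_range, List.range_eq_range']
    rcases hi : (i : ℕ) with _ | i'
    · simp [cross]
    · rw [cross_map_range', Nat.add_sub_cancel]
      refine Finset.sum_congr rfl fun j hj => ?_
      rw [Finset.mem_range] at hj
      rw [show 1 + j = j + 1 by omega, Nat.add_sub_cancel, zero_add]
      congr 1
      apply propext
      constructor
      · exact fun h => ⟨by omega, by omega, h⟩
      · exact fun h => h.2.2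
  · intro d hd
    simp only [Finset.mem_Ico] at hd ⊢
    omega
  · intro d _ hd
    simp only [Finset.mem_Ico] at hd
    rw [if_neg]
    omega

theorem cross_after_word (i : Fin m) : cross (letter σ i) (after (letter σ i) (word σ)) =
    ∑ d : Fin m, if i < d ∧ ∃ k : Fin m, (d : ℕ) + 1 = (k : ℕ) ∧
      letter σ i < letter σ d ∧ letter σ k < letter σ i then 1 else 0 := by
  have h1 : ∀ d : Fin m, (i < d ∧ ∃ k : Fin m, (d : ℕ) + 1 = (k : ℕ) ∧
      letter σ i < letter σ d ∧ letter σ k < letter σ i) ↔ ((i : ℕ) < d ∧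
      letter σ i < extLetter σ (d : ℕ) ∧ extLetter σ ((d : ℕ) + 1) < letter σ i) := by
    intro d
    refine and_congr Iff.rfl ?_
    constructor
    · rintro ⟨k, hk, h⟩
      rw [hk, extLetter_coe, extLetter_coe]
      exact h
    · rintro h
      have h2 : (d : ℕ) + 1 < m := by
        by_contra h3
        have := letter_le σ i
        have h4 := h.2
        simp only [extLetter, h3, dite_false] at h4
        omega
      rw [extLetter_coe, extLetter_of_lt σ h2] at h
      exact ⟨_, rfl, h⟩
  simp only [h1]
  have hlen : m - i = (m - (i + 1)) + 1 := by omega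
  rw [Fin.sum_univ_eq_sum_range (fun d => if (i : ℕ) < d ∧
      letter σ i < extLetter σ d ∧ extLetter σ (d + 1) < letter σ i then 1 else 0) m, after_word,
    hlen, cross_map_range', Finset.range_eq_Ico m,
    ← Finset.sum_subset (s₁ := Finset.Ico ((i : ℕ) + 1) m) (s₂ := Finset.Ico 0 m)]
  · rw [Finset.sum_Ico_eq_sum_range]
    refine Finset.sum_congr rfl fun j hj => ?_
    congr 1
    apply propext
    exact ⟨fun h => ⟨by omega, h⟩, fun h => h.2⟩
  · intro d hd
    simp only [Finset.mem_Ico] at hd ⊢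
    omega
  · intro d hd hd'
    simp only [Finset.mem_Ico] at hd hd'
    rw [if_neg]
    omega

/-- The straddled letter is the second coordinate in `les` and the first in `res`, which decides the
order of summation. -/
theorem sum_cross_before_word :
    ∑ i, cross (letter σ i) (before (letter σ i) (word σ)) = les σ := by
  simp only [cross_before_word]
  rw [les, Finset.card_filter, Fintype.sum_prod_type_right]

theorem sum_cross_after_word :
    ∑ i, cross (letter σ i) (after (letter σ i) (word σ)) = res σ := by
  simp only [cross_after_word]
  rw [res, Finset.card_filter, Fintype.sum_prod_type]

theorem des_eq_card : des σ = (Finset.univ.filter fun i => ∃ j, IsDescent σ i j).card := by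
  rw [des]
  have : (Finset.univ.filter fun i => ∃ j, IsDescent σ i j) =
      (Finset.univ.filter fun d : Fin m × Fin m => IsDescent σ d.1 d.2).image Prod.fst := by
    ext i
    simp
  rw [this, Finset.card_image_of_injOn]
  rintro ⟨i, j⟩ h ⟨i', j'⟩ h' e
  simp only [Finset.coe_filter, Finset.mem_univ, true_and, Set.mem_ofPred_eq] at h h' e
  subst e
  have := h.1.symm.trans h'.1
  simp only [Prod.mk.injEq, true_and]
  exact Fin.ext this

/-- The large letter at the end only adds an ascent. -/
theorem isChain_word : (word σ).IsChain StepRel ↔ IsEvenOddDescent σ := by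
  rw [word, List.isChain_iff_getElem]
  simp only [List.length_map, List.length_range, List.getElem_map, List.getElem_range]
  constructor
  · intro h i j hij
    have h1 := h i (by omega)
    rw [hij.1, extLetter_coe, extLetter_coe] at h1
    rcases h1 with h1 | h1
    · exact absurd hij.2 (by omega)
    · exact h1.2
  · intro h i hi
    have him : i < m := by omega
    rw [extLetter_of_lt σ him]
    by_cases hi' : i + 1 < m
    · rw [extLetter_of_lt σ hi']
      rcases lt_trichotomy (letter σ ⟨i, him⟩) (letter σ ⟨i + 1, hi'⟩) with h1 | h1 | h1
      · exact Or.inl h1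
      · have := congrArg Fin.val (letter_injective σ h1)
        simp at this
      · exact Or.inr ⟨h1, h _ _ ⟨rfl, h1⟩⟩
    · have := letter_le σ ⟨i, him⟩
      left
      simp only [extLetter, hi', dite_false]
      omega

theorem isBlockWord_word (h : IsEvenOddDescent σ) : IsBlockWord (m + 2) m (word σ) := by
  refine ⟨(isChain_word σ).2 h, ⟨_, word_eq_append σ⟩, ?_, ?_⟩
  · intro x hx
    rw [word_eq_append] at hx
    simp only [List.mem_append, List.mem_map, List.mem_range, List.mem_singleton] at hx
    rcases hx with ⟨i, hi, rfl⟩ | h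
    · rw [extLetter_of_lt σ hi]
      exact Or.inr ⟨letter_pos σ _, letter_le σ _⟩
    · exact Or.inl h
  · intro v hv hv'
    obtain ⟨i, rfl⟩ := exists_letter_eq σ hv hv'
    rw [word_eq_cut σ i, List.count_append, List.count_cons_self,
      List.count_eq_zero_of_not_mem (letter_notMem σ i), List.count_eq_zero_of_not_mem]
    intro h
    obtain ⟨j, hj, h⟩ := List.mem_map.1 h
    rw [List.mem_range'_1] at hj
    by_cases hjm : j < m
    · rw [extLetter_of_lt σ hjm] at h
      have := congrArg Fin.val (letter_injective σ h)
      simp only at this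
      omega
    · simp only [extLetter, hjm, dite_false] at h
      omega

theorem count_word : (word σ).count (m + 2) = 1 := by
  rw [word_eq_append, List.count_append, List.count_eq_zero_of_not_mem, List.count_singleton_self]
  intro h
  obtain ⟨j, hj, h⟩ := List.mem_map.1 h
  rw [List.mem_range] at hj
  have := letter_le σ ⟨j, hj⟩
  rw [extLetter_of_lt σ hj] at h
  omega

theorem word_injective : Function.Injective (word : Equiv.Perm (Fin m) → List ℕ) := by
  intro σ τ h
  ext i
  have h1 : extLetter σ i = extLetter τ i :=
    List.map_inj_left.1 h i (List.mem_range.2 (by omega))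
  rw [extLetter_coe, extLetter_coe] at h1
  simpa [letter] using h1

/-- The only gap is the final one, so the rest lists each of `1, …, m` once and has length `m`. -/
theorem exists_word_eq {d : List ℕ} (hd : IsBlockWord (m + 2) m d) (h1 : d.count (m + 2) = 1) :
    ∃ σ : Equiv.Perm (Fin m), IsEvenOddDescent σ ∧ word σ = d := by
  obtain ⟨s, rfl⟩ := hd.last
  have hmem : ∀ x, x ∈ s ↔ 1 ≤ x ∧ x ≤ m := by
    intro x
    constructor
    · intro hx
      refine (hd.mem x (by simp [hx])).resolve_left ?_
      rintro rfl
      have := List.count_pos_iff.2 hx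
      simp only [List.count_append, List.count_singleton_self] at h1
      omega
    · rintro ⟨hx, hx'⟩
      have := hd.count x hx hx'
      rw [List.count_append, List.count_cons_of_ne (by omega), List.count_nil] at this
      exact List.count_pos_iff.1 (by omega)
  have hnd : s.Nodup := by
    rw [List.nodup_iff_count_le_one]
    intro x
    by_cases hx : x ∈ s
    · have h2 := (hmem x).1 hx
      have := hd.count x h2.1 h2.2
      rw [List.count_append] at this
      omega
    · rw [List.count_eq_zero_of_not_mem hx]
      omega
  have hlen : s.length = m := by
    have : s.toFinset = Finset.Icc 1 m := by ext x; simp [hmem]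
    rw [← List.toFinset_card_of_nodup hnd, this]
    simp
  have hget : ∀ i : Fin m, 1 ≤ s[i]'(by omega) ∧ s[i]'(by omega) ≤ m := fun i =>
    (hmem _).1 (List.getElem_mem _)
  let f : Fin m → Fin m := fun i => ⟨s[i]'(by omega) - 1, by have := hget i; omega⟩
  have hf : Function.Injective f := by
    intro i j h
    have h2 := congrArg Fin.val h
    have h3 := hget i
    have h4 := hget j
    simp only [f] at h2
    have h5 : s[(i : ℕ)]'(by omega) = s[(j : ℕ)]'(by omega) := by
      simp only [Fin.getElem_fin] at *
      omega
    exact Fin.ext ((hnd.getElem_inj_iff).1 h5)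
  let σ := Equiv.ofBijective f (Finite.injective_iff_bijective.1 hf)
  have hword : word σ = s ++ [m + 2] := by
    rw [word_eq_append]
    congr 1
    apply List.ext_getElem
    · simp [hlen]
    · intro i hi hi'
      simp only [List.length_map, List.length_range] at hi
      have := hget ⟨i, hi⟩
      rw [List.getElem_map, List.getElem_range, extLetter_of_lt σ hi]
      exact Nat.sub_add_cancel this.1
  refine ⟨σ, ?_, hword⟩
  rw [← isChain_word, hword]
  exact hd.chain

end Words

/-! ### Comparison with the statistics of permutations -/

section Main

variable {R : Type*} [CommRing R] (a abar b bbar p q y t : R)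

theorem prod_ite_one {α : Type*} (s : Finset α) (P : α → Prop) [DecidablePred P] (x : R) :
    ∏ i ∈ s, (if P i then x else 1) = x ^ (s.filter P).card := by
  simp [Finset.prod_ite]

theorem prod_letterWeight_word {m : ℕ} (σ : Equiv.Perm (Fin m)) :
    ∏ i, letterWeight a abar b bbar p q t (letter σ i) (word σ) =
      a ^ lema σ * abar ^ loma σ * b ^ romi σ * bbar ^ remi σ * p ^ res σ * q ^ les σ *
        t ^ des σ := by
  have h1 : ∀ i, letterWeight a abar b bbar p q t (letter σ i) (word σ) =
      (if IsLRMax σ i ∧ Even (letter σ i) then a else 1) *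
      (if IsLRMax σ i ∧ Odd (letter σ i) then abar else 1) *
      (if IsRLMin σ i ∧ Odd (letter σ i) then b else 1) *
      (if IsRLMin σ i ∧ Even (letter σ i) then bbar else 1) *
      p ^ cross (letter σ i) (after (letter σ i) (word σ)) *
      q ^ cross (letter σ i) (before (letter σ i) (word σ)) *
      (if ∃ j, IsDescent σ i j then t else 1) := by
    intro i
    simp only [letterWeight, localWeight, forall_before_word, forall_after_word,
      lowHead_after_word, ← Nat.not_even_iff_odd]
    by_cases h1 : IsLRMax σ i <;> by_cases h2 : IsRLMin σ i <;>
      by_cases h3 : Even (letter σ i) <;> simp [h1, h2, h3]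
  simp only [h1, Finset.prod_mul_distrib, prod_ite_one, Finset.prod_pow_eq_pow_sum,
    sum_cross_before_word, sum_cross_after_word, des_eq_card, lema, loma, remi, romi]

theorem prod_range_two_mul (f : ℕ → R) (n : ℕ) :
    ∏ i ∈ Finset.range n, f (2 * i + 1) * f (2 * i + 2) =
      ∏ i ∈ Finset.range (2 * n), f (i + 1) := by
  induction n with
  | zero => simp
  | succ n ih =>
    rw [Finset.prod_range_succ, ih, show 2 * (n + 1) = 2 * n + 1 + 1 by ring,
      Finset.prod_range_succ, Finset.prod_range_succ, mul_assoc]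

theorem blockWeight_word {n : ℕ} (σ : Equiv.Perm (Fin (2 * n))) :
    blockWeight a abar b bbar p q y t n (word σ) =
      a ^ lema σ * abar ^ loma σ * b ^ romi σ * bbar ^ remi σ * p ^ res σ * q ^ les σ *
        y ^ dom σ * t ^ des σ := by
  have h1 : ∏ i ∈ Finset.range n, (letterWeight a abar b bbar p q t (2 * i + 1) (word σ) *
      letterWeight a abar b bbar p q t (2 * i + 2) (word σ)) =
      ∏ i, letterWeight a abar b bbar p q t (letter σ i) (word σ) := by
    rw [prod_range_two_mul fun v => letterWeight a abar b bbar p q t v (word σ),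
      ← Fin.prod_univ_eq_prod_range fun v => letterWeight a abar b bbar p q t (v + 1) (word σ)]
    -- The product over values becomes one over positions, by reindexing along `σ`.
    exact (Equiv.prod_comp σ fun i : Fin (2 * n) =>
      letterWeight a abar b bbar p q t ((i : ℕ) + 1) (word σ)).symm
  have h2 : ∏ i ∈ Finset.range n, (if LowHead (2 * i + 2) (after (2 * i + 2) (word σ)) ∧
      HighLast (2 * i + 1) (before (2 * i + 1) (word σ)) then y else 1) = y ^ dom σ := by
    rw [prod_ite_one, dom]
    congr 1
    rw [Finset.card_filter, Finset.card_filter, sum_Icc_one]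
    refine Finset.sum_congr rfl fun i hi => ?_
    rw [Finset.mem_range] at hi
    simp only [lowHead_after_word_iff σ (show 1 ≤ 2 * i + 2 by omega) (by omega),
      highLast_before_word_iff σ (show 1 ≤ 2 * i + 1 by omega) (by omega)]
    rfl
  simp only [blockWeight, pairWeight]
  rw [Finset.prod_mul_distrib, h1, h2, prod_letterWeight_word]
  ring

/-- The test function `Pi.single 0 1` keeps the block words whose only gap is the final one, and
these are the words of even-odd descent permutations. -/
theorem polyX_eq_iterate (n : ℕ) :
    polyX a abar b bbar p q y t n =
      (transfer a abar b bbar p q y t)^[n] (Pi.single 0 1) 0 := by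
  -- The gap letter must be even and exceed `2 * n`, which rules out `2 * n + 1`.
  have hNe : Even (2 * n + 2) := ⟨n + 1, by ring⟩
  rw [← sum_blockWords a abar b bbar p q y t hNe n (by omega),
    ← List.sum_toFinset _ (nodup_blockWords hNe n (by omega)), polyX]
  refine Finset.sum_of_injOn word (word_injective.injOn) ?_ ?_ ?_
  · intro σ hσ
    simp only [evenOddPerms, Finset.coe_filter, Finset.mem_univ, true_and,
      Set.mem_ofPred_eq] at hσ
    simp only [List.coe_toFinset, Set.mem_ofPred_eq, mem_blockWords hNe n (by omega : 2 * n < _)]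
    exact isBlockWord_word σ hσ
  · intro d hd hd'
    rw [List.mem_toFinset, mem_blockWords hNe n (by omega)] at hd
    have h1 : d.count (2 * n + 2) - 1 ≠ 0 := by
      intro h
      obtain ⟨s, hs⟩ := hd.last
      have h2 : d.count (2 * n + 2) = 1 := by
        have : 0 < d.count (2 * n + 2) := List.count_pos_iff.2 (by simp [hs])
        omega
      obtain ⟨σ, hσ, h3⟩ := exists_word_eq hd h2
      exact hd' ⟨σ, by simpa [evenOddPerms] using hσ, h3⟩
    rw [Pi.single_eq_of_ne h1, mul_zero]
  · intro σ _
    rw [count_word, blockWeight_word]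
    simp

end Main

end EvenOddDescent

theorem mainTheorem2 {R : Type*} [CommRing R] (a abar b bbar p q y t : R) :
    EvenOddDescent.IsJFraction
        (fun k => EvenOddDescent.coeffB a abar b bbar p q y t (k + 1))
        (fun n => EvenOddDescent.coeffLam a abar b bbar p q t n)
        (1 + PowerSeries.mk fun n =>
          if n = 0 then 0 else EvenOddDescent.polyX a abar b bbar p q y t n) ∧
      EvenOddDescent.coeffB a abar b bbar p q y t 1 = a * b * (abar * bbar + t * y) ∧
      EvenOddDescent.coeffLam a abar b bbar p q t 1 =
        a * b * t * (a * p + bbar * q) * (abar * p + b * q) := by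
  open EvenOddDescent in
  refine ⟨?_, ?_, ?_⟩
  · have h : (1 + PowerSeries.mk fun n =>
          if n = 0 then 0 else polyX a abar b bbar p q y t n) =
        pathSeries (fun h => pqInt b (h + 1) q p * pqIntTwo a (h + 2) bbar p q)
          (fun h => coeffB a abar b bbar p q y t (h + 1))
          (fun h => pqIntTwo abar (h + 2) b p q * (t * pqInt a (h + 1) p q)) 0 := by
      ext n
      rcases n with _ | n
      · simp [pathSeries]
      · simp [pathSeries, PowerSeries.coeff_one, polyX_eq_iterate, transfer]
    rw [h]
    refine isJFraction_pathSeries _ _ _ _ fun h => ?_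
    simp only [coeffLam]
    ring
  · simp [coeffB, pqInt, pqIntTwo]
    ring
  · simp [coeffLam, pqInt, pqIntTwo]
    ring
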